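/- A finite set $P$ of points in the Euclidean plane is in convex position if no point of $P$ lies in the convex hull of the other points of $P$ (for at least three points: $P$ is the vertex set of a convex polygon). Call an unordered pair $\{a,b\}$ of distinct points of $P$ a good edge of $P$ if the perpendicular bisector of the segment $ab$ passes through at most one point of $P$. Let $Z(P)$ be the number of unordered pairs $\{(p,a),(p,b)\}$ such that $p,a,b$ are three distinct points of $P$ with $|pa|=|pb|$; that is, $Z(P)$ is the number of isosceles triangles determined by $P$, where each equilateral triangle is counted three times. Let $n\ge 2$ and let $P$ be a set of $n$ points in the plane in convex position. Then $P$ has at least $n^2/11.981$ good edges, and consequently $$Z(P)\le \frac{10.981}{11.981}\,n^2 .$$ -/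

import Mathlib

/-- The Euclidean plane. -/
abbrev Plane : Type := EuclideanSpace ℝ (Fin 2)

/-- A finite planar point set is in convex position if no point of it lies in the convex hull of
the others; for at least three points this says that it is the vertex set of a convex polygon. -/
def InConvexPosition (P : Finset Plane) : Prop :=
  ConvexIndependent ℝ ((↑) : ↥(P : Set Plane) → Plane)

/-- The perpendicular bisector of the segment `ab` passes through at most one point of `P`. -/
def IsGood (P : Finset Plane) (a b : Plane) : Prop :=
  ((P : Set Plane) ∩ (AffineSubspace.perpBisector a b : Set Plane)).Subsingleton

/-- The good edges of `P`: unordered pairs of distinct points of `P` whose perpendicular bisector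
passes through at most one point of `P`. -/
def goodEdges (P : Finset Plane) : Set (Sym2 Plane) :=
  {e | ∃ a ∈ P, ∃ b ∈ P, a ≠ b ∧ IsGood P a b ∧ e = s(a, b)}

/-- The unordered pairs `{(p, a), (p, b)}` with `p, a, b` three distinct points of `P` such that
`|pa| = |pb|`. -/
def isoscelesPairs (P : Finset Plane) : Set (Sym2 (Plane × Plane)) :=
  {t | ∃ p ∈ P, ∃ a ∈ P, ∃ b ∈ P,
    p ≠ a ∧ p ≠ b ∧ a ≠ b ∧ dist p a = dist p b ∧ t = s((p, a), (p, b))}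

/-- The number `Z(P)` of isosceles triangles determined by `P`, an equilateral triangle being
counted three times. Both this set and the set of good edges are finite, as `P` is. -/
noncomputable def numIsosceles (P : Finset Plane) : ℕ := (isoscelesPairs P).ncard

/-!
Write `Z(P)` as the sum over all edges of the number of points on their bisectors. No line contains
three points of `P`, so this number is at most two, and at most one for a good edge; hence
`Z(P) + #good ≤ n (n - 1)`, and everything rests on the lower bound for good edges.

**The bound `n² / 12`.** The minimum enclosing circle has two diametral contact points, or three
contact points that span a triangle containing the centre (`exists_contact_points`). They cut the
convex polygon `P` into two or three arcs in which all angles are right or obtuse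
(`IsPolygon.isObtuseArc_of_chord`). A bad edge has points of `P` on its bisector on both sides
(`IsPolygon.exists_apex_of_not_isGood`), so a bad edge inside an arc has an apex between its ends.
In an obtuse arc with `N + 1` points the distances from a point increase in either direction, so the
`k`-th point is the apex of at most `min k (N - k)` pairs, and at least `(N² + 2 N) / 4` pairs are
good. If there are two arcs, this gives `n² / 8`; with three arcs it gives `n² / 12 + n / 2`, which
exceeds `n² / 11.981` unless `n > 3700`.

**The gain.** Suppose that there are fewer than `n² / 11.981` good edges and hence three arcs. Then
the arcs have nearly `n / 3` points each, and for nearly all points of an arc nearly all points on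
the shorter side are matched with equidistant ones on the other side; the total defect is below
`0.0001322 n²`. Let `v = a₀` be the corner opposite to the longest side of the triangle of contact
points; its angle is at least `60°`. Let `a₀, a₁, …` and `b₀ = v, b₁, …` be the two arcs at `v`,
named such that `b_l` is not farther from `v` than `a_l`, where `l ≈ n / 64`. Consider the edges
`a_r b_j` with `l < r ≤ L ≈ 0.157 n` and `1 ≤ j ≤ l`. If such an edge is bad, it has an apex `a_t`
with `t < r`; an apex among the `b` is excluded since `b_j` is not farther from `v` than `a_r` is.
The angle at `v` gives `|a_t a_r|² = |a_t b_j|² ≥ |a_t v|² / 2`. On the other hand, the matching at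
`a_q` with `q ≈ t / 2` shows `|a_q a_t| ≤ |a_q v|`, so that `|a_t a_q|² ≤ |a_t v|² / 2` because the
angle at `a_q` is not acute. The points between `a_q` and `a_t` are therefore at most as far from
`a_t` as `a_r` is, and the matching at `a_t` forces `r - t ≥ t / 2` up to the defects
(`add_card_matchedSet_le`). So only about `2 L / 3` values of `t` are possible
(`exists_card_le_of_defect`). As `t` and `j` determine `r`, each `b_j` is in at least about
`L / 3 - l` good edges up to the defects (`card_good_cross`), which add up to more than
`0.0002 n²` further good edges, too many (`sq_le_of_cross_estimate`).
-/

/-! ### Planar orientation and angles -/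

/-- The determinant of two plane vectors. -/
def planeDet (u v : Plane) : ℝ := u 0 * v 1 - u 1 * v 0

/-- Twice the signed area of the triangle `abc`, positive for counterclockwise triangles. -/
def signedArea (a b c : Plane) : ℝ := planeDet (b - a) (c - a)

lemma signedArea_eq (a b c : Plane) :
    signedArea a b c = (b 0 - a 0) * (c 1 - a 1) - (b 1 - a 1) * (c 0 - a 0) := rfl

lemma signedArea_rotate (a b c : Plane) : signedArea b c a = signedArea a b c := by
  simp only [signedArea_eq]; ring

lemma plane_dist_sq (a b : Plane) : dist a b ^ 2 = (a 0 - b 0) ^ 2 + (a 1 - b 1) ^ 2 := by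
  simp [EuclideanSpace.dist_sq_eq, Fin.sum_univ_two, Real.dist_eq]

lemma plane_inner (u v : Plane) : inner ℝ u v = u 0 * v 0 + u 1 * v 1 := by
  simp [PiLp.inner_apply, Fin.sum_univ_two]; ring

lemma plane_norm_sq (u : Plane) : ‖u‖ ^ 2 = u 0 ^ 2 + u 1 ^ 2 := by
  simp [EuclideanSpace.norm_sq_eq, Fin.sum_univ_two]

lemma plane_dist_eq_iff {a b c d : Plane} :
    dist a b = dist c d ↔ dist a b ^ 2 = dist c d ^ 2 :=
  (sq_eq_sq₀ dist_nonneg dist_nonneg).symm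

/-- Widening an angle that stays below a straight angle keeps an upper bound on its cosine. The
sign `σ` fixes the direction of rotation. -/
lemma inner_le_of_turn {σ c : ℝ} {u x y : Plane} (hux : 0 < σ * planeDet u x)
    (hxy : 0 ≤ σ * planeDet x y) (huy : 0 < σ * planeDet u y) (hc : 0 ≤ c)
    (h : inner ℝ u x ≤ c * (‖u‖ * ‖x‖)) : inner ℝ u y ≤ c * (‖u‖ * ‖y‖) := by
  have hcos : inner ℝ u y * ‖x‖ ^ 2
      = inner ℝ u x * inner ℝ x y - planeDet u x * planeDet x y := by
    simp only [plane_inner, plane_norm_sq, planeDet]; ring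
  have hsin : planeDet u y * ‖x‖ ^ 2
      = planeDet u x * inner ℝ x y + inner ℝ u x * planeDet x y := by
    simp only [plane_inner, plane_norm_sq, planeDet]; ring
  have hx : 0 < ‖x‖ ^ 2 := by
    have : x ≠ 0 := by rintro rfl; simp [planeDet] at hux
    positivity
  have hσ : 0 < σ ^ 2 := by
    have : σ ≠ 0 := by rintro rfl; simp at hux
    positivity
  have hprod : 0 ≤ planeDet u x * planeDet x y := by
    have := mul_nonneg hux.le hxy
    have h2 : σ ^ 2 * (planeDet u x * planeDet x y) = σ * planeDet u x * (σ * planeDet x y) := by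
      ring
    exact nonneg_of_mul_nonneg_right (h2 ▸ this) hσ
  have hpos : 0 ≤ c * (‖u‖ * ‖y‖) := by positivity
  refine le_of_mul_le_mul_right ?_ hx
  rcases le_or_gt 0 (inner ℝ x y) with h1 | h1
  · have h2 := mul_le_mul_of_nonneg_right h h1
    have h3 := mul_le_mul_of_nonneg_left (real_inner_le_norm x y)
      (show 0 ≤ c * (‖u‖ * ‖x‖) by positivity)
    nlinarith
  · rcases le_or_gt 0 (inner ℝ u x) with h2 | h2
    · have := mul_nonpos_of_nonneg_of_nonpos h2 h1.le
      have := mul_nonneg hpos hx.le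
      linarith
    · -- two obtuse turns would exceed a straight angle
      exfalso
      have h3 : σ * planeDet u x * inner ℝ x y < 0 := mul_neg_of_pos_of_neg hux h1
      have h4 : inner ℝ u x * (σ * planeDet x y) ≤ 0 :=
        mul_nonpos_of_nonpos_of_nonneg h2.le hxy
      have h5 : 0 < σ * planeDet u y * ‖x‖ ^ 2 := mul_pos huy hx
      have h6 : σ * planeDet u y * ‖x‖ ^ 2
          = σ * planeDet u x * inner ℝ x y + inner ℝ u x * (σ * planeDet x y) := by
        linear_combination σ * hsin
      linarith

/-- A point of a disc that a chord separates from the centre sees the chord under an angle of at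
least a right angle. -/
lemma inner_nonpos_of_chord {σ : ℝ} {s e j o : Plane} (hse : dist s o = dist e o)
    (hj : dist j o ≤ dist s o) (ho : 0 ≤ σ * signedArea s e o)
    (hside : 0 < σ * signedArea s j e) : inner ℝ (s - j) (e - j) ≤ 0 := by
  have hσ : 0 < σ ^ 2 := by
    have : σ ≠ 0 := by rintro rfl; simp at hside
    positivity
  have hprod : signedArea s e o * signedArea s e j ≤ 0 := by
    have h1 : 0 ≤ σ * signedArea s e o * (σ * signedArea s j e) := mul_nonneg ho hside.le
    have h2 : σ ^ 2 * (signedArea s e o * signedArea s e j)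
        = -(σ * signedArea s e o * (σ * signedArea s j e)) := by
      simp only [signedArea_eq]; ring
    nlinarith
  have hne : 0 < dist s e ^ 2 := by
    have : s ≠ e := by
      rintro rfl; simp only [signedArea_eq] at hside; ring_nf at hside; exact lt_irrefl _ hside
    have := dist_pos.2 this
    positivity
  have hj2 : dist j o ^ 2 ≤ dist s o ^ 2 := pow_le_pow_left₀ dist_nonneg hj 2
  have hse2 := plane_dist_eq_iff.1 hse
  have key : dist s e ^ 2 * inner ℝ (s - j) (e - j)
      = dist s e ^ 2 * (dist j o ^ 2 - dist s o ^ 2)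
        + 2 * (signedArea s e o * signedArea s e j) := by
    simp only [plane_dist_sq] at hse2
    simp only [plane_dist_sq, plane_inner, signedArea_eq, PiLp.sub_apply]
    linear_combination ((e 0 - s 0) * (j 0 - s 0) + (e 1 - s 1) * (j 1 - s 1)) * hse2
  have : dist s e ^ 2 * inner ℝ (s - j) (e - j) ≤ 0 := by nlinarith
  exact nonpos_of_mul_nonpos_right this hne

/-- In a convex quadrilateral `x y b v` with `v` not farther from `y` than from `x`, the vertex `b`
is not on the bisector of `xy`: otherwise the diagonal `vy` would lie on the `y` side of the bisector
and the diagonal `xb` on the `x` side, and they could not cross. -/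
lemma dist_ne_of_convex_quadrilateral {σ : ℝ} {x y b v : Plane} (h1 : 0 < σ * signedArea y b v)
    (h2 : 0 < σ * signedArea x b v) (h3 : 0 < σ * signedArea x y b) (hv : dist v y ≤ dist v x) :
    dist b x ≠ dist b y := by
  intro hb
  have hb2 := plane_dist_eq_iff.1 hb
  have hv2 : dist v y ^ 2 ≤ dist v x ^ 2 := pow_le_pow_left₀ dist_nonneg hv 2
  have hne : 0 < dist x y ^ 2 := by
    have : x ≠ y := by
      rintro rfl; simp only [signedArea_eq] at h3; ring_nf at h3; exact lt_irrefl _ h3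
    have := dist_pos.2 this
    positivity
  -- `f z = |zx|² - |zy|²` is affine, so it respects the affine relation given by the diagonals
  have key : σ * signedArea y b v * (-dist x y ^ 2)
      = σ * signedArea x b v * dist x y ^ 2
        + σ * signedArea x y b * (dist v x ^ 2 - dist v y ^ 2) := by
    simp only [plane_dist_sq] at hb2
    simp only [plane_dist_sq, signedArea_eq]
    linear_combination (-σ * ((y 0 - x 0) * (v 1 - x 1) - (y 1 - x 1) * (v 0 - x 0))) * hb2
  have e1 := mul_pos h1 hne
  have e2 := mul_pos h2 hne
  have e3 := mul_nonneg h3.le (sub_nonneg.2 hv2)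
  linarith

/-- If `u` and `y` seen from `v` make an angle of at least `60°`, then `y` is not much closer to
`u` than `v` is. -/
lemma half_dist_sq_le_of_inner_le {v t y : Plane}
    (h : inner ℝ (t - v) (y - v) ≤ 1 / 2 * (‖t - v‖ * ‖y - v‖)) :
    dist t v ^ 2 ≤ 2 * dist t y ^ 2 := by
  have e1 : dist t y ^ 2 = ‖t - v‖ ^ 2 + ‖y - v‖ ^ 2 - 2 * inner ℝ (t - v) (y - v) := by
    simp only [plane_dist_sq, plane_norm_sq, plane_inner, PiLp.sub_apply]; ring
  rw [e1, dist_eq_norm]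
  nlinarith [sq_nonneg (‖t - v‖ - ‖y - v‖), sq_nonneg (‖y - v‖), sq_nonneg (‖t - v‖)]

/-- The angle opposite to a longest side of a triangle is at least `60°`. -/
lemma inner_le_half_of_longest {v u x : Plane} (h1 : dist u v ≤ dist u x)
    (h2 : dist x v ≤ dist u x) : inner ℝ (u - v) (x - v) ≤ 1 / 2 * (‖u - v‖ * ‖x - v‖) := by
  have e1 : dist u x ^ 2 = ‖u - v‖ ^ 2 + ‖x - v‖ ^ 2 - 2 * inner ℝ (u - v) (x - v) := by
    simp only [plane_dist_sq, plane_norm_sq, plane_inner, PiLp.sub_apply]; ring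
  have h1' : ‖u - v‖ ^ 2 ≤ dist u x ^ 2 := by
    rw [← dist_eq_norm]; exact pow_le_pow_left₀ dist_nonneg h1 2
  have h2' : ‖x - v‖ ^ 2 ≤ dist u x ^ 2 := by
    rw [← dist_eq_norm]; exact pow_le_pow_left₀ dist_nonneg h2 2
  rcases le_total ‖u - v‖ ‖x - v‖ with h | h
  · nlinarith [norm_nonneg (u - v), norm_nonneg (x - v)]
  · nlinarith [norm_nonneg (u - v), norm_nonneg (x - v)]

lemma dist_sq_add_le_of_inner_nonpos {a b c : Plane} (h : inner ℝ (a - b) (c - b) ≤ 0) :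
    dist a b ^ 2 + dist b c ^ 2 ≤ dist a c ^ 2 := by
  have : dist a c ^ 2 = dist a b ^ 2 + dist b c ^ 2 - 2 * inner ℝ (a - b) (c - b) := by
    simp only [plane_dist_sq, plane_inner, PiLp.sub_apply]; ring
  linarith

/-! ### Cyclic labelling of a set in convex position -/

/-- `p 0, …, p (n - 1)`, followed by `p n = p 0`, lists the points of `P` in cyclic order along the
convex polygon that they span. Only the sign of `σ` matters: it is positive for counterclockwise
and negative for clockwise order. -/
structure IsPolygon (P : Finset Plane) (n : ℕ) (σ : ℝ) (p : ℕ → Plane) : Prop where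
  closed : p n = p 0
  inj : ∀ i < n, ∀ j < n, p i = p j → i = j
  mem : ∀ i ≤ n, p i ∈ P
  surj : ∀ x ∈ P, ∃ i < n, p i = x
  orient : ∀ i j k, i < j → j < k → k ≤ n → k < i + n → 0 < σ * signedArea (p i) (p j) (p k)

lemma IsPolygon.reverse {P : Finset Plane} {n : ℕ} {σ : ℝ} {p : ℕ → Plane}
    (h : IsPolygon P n σ p) : IsPolygon P n (-σ) (fun i => p (n - i)) where
  closed := by simp [h.closed]
  inj i hi j hj hij := by
    have key : ∀ i < n, ∃ i' < n, p (n - i) = p i' ∧ (i = 0 ∧ i' = 0 ∨ 0 < i ∧ i' = n - i) := by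
      intro i hi
      rcases Nat.eq_zero_or_pos i with rfl | h0
      · exact ⟨0, hi, by simpa using h.closed, Or.inl ⟨rfl, rfl⟩⟩
      · exact ⟨n - i, by omega, rfl, Or.inr ⟨h0, rfl⟩⟩
    obtain ⟨i', hi', e1, c1⟩ := key i hi
    obtain ⟨j', hj', e2, c2⟩ := key j hj
    have := h.inj i' hi' j' hj' (by rw [← e1, ← e2]; exact hij)
    omega
  mem i _ := h.mem _ (Nat.sub_le _ _)
  surj x hx := by
    obtain ⟨i, hi, rfl⟩ := h.surj x hx
    rcases Nat.eq_zero_or_pos i with rfl | h0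
    · exact ⟨0, hi, by simpa using h.closed⟩
    · exact ⟨n - i, by omega, by congr 1; omega⟩
  orient i j k hij hjk hk hki := by
    have := h.orient (n - k) (n - j) (n - i) (by omega) (by omega) (by omega) (by omega)
    simp only [signedArea_eq] at this ⊢
    linarith

/-- The three smaller areas are, up to the factor `signedArea v x y`, barycentric coordinates. -/
lemma mem_convexHull_triple {v x j y : Plane} (h : 0 < signedArea v x y)
    (h1 : 0 ≤ signedArea v x j) (h2 : 0 ≤ signedArea v j y) (h3 : 0 ≤ signedArea j x y) :
    j ∈ convexHull ℝ ({v, x, y} : Set Plane) := by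
  have hs : signedArea j x y + signedArea v j y + signedArea v x j = signedArea v x y := by
    simp only [signedArea_eq]; ring
  have hne := h.ne'
  have hj : j = (signedArea j x y / signedArea v x y) • v + (signedArea v j y / signedArea v x y) • x
      + (signedArea v x j / signedArea v x y) • y := by
    ext i
    fin_cases i
    · simp only [Fin.zero_eta, PiLp.add_apply, PiLp.smul_apply, smul_eq_mul]
      field_simp
      simp only [signedArea_eq]; ring
    · simp only [Fin.mk_one, PiLp.add_apply, PiLp.smul_apply, smul_eq_mul]
      field_simp
      simp only [signedArea_eq]; ring
  have hc := convex_convexHull ℝ ({v, x, y} : Set Plane)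
  have hv : v ∈ convexHull ℝ ({v, x, y} : Set Plane) := subset_convexHull _ _ (by simp)
  have hx : x ∈ convexHull ℝ ({v, x, y} : Set Plane) := subset_convexHull _ _ (by simp)
  have hy : y ∈ convexHull ℝ ({v, x, y} : Set Plane) := subset_convexHull _ _ (by simp)
  have := hc.sum_mem (t := (Finset.univ : Finset (Fin 3)))
    (w := ![signedArea j x y / signedArea v x y, signedArea v j y / signedArea v x y,
      signedArea v x j / signedArea v x y]) (z := ![v, x, y])
    (by intro i _; fin_cases i <;> simp <;> positivity)
    (by simp [Fin.sum_univ_three]; field_simp; linarith)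
    (by intro i _; fin_cases i <;> simpa)
  simp only [Fin.sum_univ_three, Matrix.cons_val_zero, Matrix.cons_val_one, Matrix.cons_val] at this
  rwa [← hj] at this

/-- A set in convex position has a counterclockwise cyclic labelling that starts at a given point:
sort the other points by their slope as seen from it. -/
lemma exists_isPolygon {P : Finset Plane} {n : ℕ} (hn : 2 ≤ n) (hcard : P.card = n)
    (hP : InConvexPosition P) {v : Plane} (hv : v ∈ P) :
    ∃ p, IsPolygon P n 1 p ∧ p 0 = v := by
  have hP' := convexIndependent_set_iff_notMem_convexHull_sdiff.1 hP
  -- a linear functional that separates `v` from the other points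
  obtain ⟨f, u, hfv, hfu⟩ := geometric_hahn_banach_point_closed (convex_convexHull ℝ _)
    (((P.finite_toSet.subset (Set.sdiff_subset : (P : Set Plane) \ {v} ⊆ P)).isCompact_convexHull
      (𝕜 := ℝ)).isClosed) (hP' v hv)
  have hf : ∀ x ∈ P.erase v, 0 < f (x - v) := by
    intro x hx
    have := hfu x (subset_convexHull _ _ (by simpa [and_comm] using hx))
    rw [map_sub]; linarith
  set α := f (EuclideanSpace.single 0 1) with hα
  set β := f (EuclideanSpace.single 1 1) with hβ
  have hfz : ∀ z : Plane, f z = α * z 0 + β * z 1 := by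
    intro z
    have hz : z = z 0 • EuclideanSpace.single 0 1 + z 1 • EuclideanSpace.single 1 1 := by
      ext i; fin_cases i <;> simp
    conv_lhs => rw [hz]
    simp only [map_add, map_smul, smul_eq_mul]; ring
  -- the slope of a point as seen from `v`; it orders the other points counterclockwise
  set κ : Plane → ℝ := fun x => (α * (x - v) 1 - β * (x - v) 0) / f (x - v) with hκ
  have hlt : ∀ x ∈ P.erase v, ∀ y ∈ P.erase v, κ x < κ y → 0 < signedArea v x y := by
    intro x hx y hy hxy
    have h1 := hf x hx
    have h2 := hf y hy
    rw [hκ] at hxy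
    simp only at hxy
    rw [div_lt_div_iff₀ h1 h2, hfz, hfz] at hxy
    have : 0 < (α ^ 2 + β ^ 2) * signedArea v x y := by
      simp only [signedArea_eq, PiLp.sub_apply] at hxy ⊢
      nlinarith
    exact pos_of_mul_pos_right this (by positivity)
  have hcol : ∀ x ∈ P.erase v, ∀ y ∈ P.erase v, ∀ j ∈ P.erase v, x ≠ j → y ≠ j →
      0 < signedArea v x y → 0 ≤ signedArea v x j → 0 ≤ signedArea v j y →
      0 < signedArea x j y := by
    intro x hx y hy j hj hxj hyj h h1 h2
    by_contra! h3
    refine hP' j (Finset.mem_of_mem_erase hj) ?_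
    have : signedArea j x y = -signedArea x j y := by simp only [signedArea_eq]; ring
    refine convexHull_mono ?_ (mem_convexHull_triple h h1 h2 (by linarith))
    have := Finset.ne_of_mem_erase hj
    simp only [Set.insert_subset_iff, Set.singleton_subset_iff, Set.mem_sdiff, Finset.mem_coe,
      Set.mem_singleton_iff]
    exact ⟨⟨hv, this.symm⟩, ⟨Finset.mem_of_mem_erase hx, hxj⟩, ⟨Finset.mem_of_mem_erase hy, hyj⟩⟩
  have hκinj : Set.InjOn κ (P.erase v : Finset Plane) := by
    intro x hx y hy hxy
    by_contra hne
    have h1 := hf x hx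
    have h2 := hf y hy
    rw [hκ] at hxy
    simp only at hxy
    rw [div_eq_div_iff h1.ne' h2.ne'] at hxy
    have hab : 0 < α ^ 2 + β ^ 2 := by
      rw [hfz] at h1
      by_contra! h0
      have ha : α = 0 := by nlinarith [sq_nonneg α, sq_nonneg β]
      have hb : β = 0 := by nlinarith [sq_nonneg α, sq_nonneg β]
      rw [ha, hb] at h1; simp at h1
    -- `x` and `y` on one ray from `v`: the nearer one lies on a segment
    have hray : ∀ x ∈ P.erase v, ∀ y ∈ P.erase v, x ≠ y →
        (α * (x - v) 1 - β * (x - v) 0) * f (y - v) = (α * (y - v) 1 - β * (y - v) 0) * f (x - v) →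
        f (x - v) ≤ f (y - v) → False := by
      intro x hx y hy hxy he hle
      have h1 := hf x hx
      have h2 := hf y hy
      refine hP' x (Finset.mem_of_mem_erase hx) ?_
      have hseg : x ∈ segment ℝ v y := by
        refine ⟨1 - f (x - v) / f (y - v), f (x - v) / f (y - v), ?_, by positivity, by ring, ?_⟩
        · rw [sub_nonneg, div_le_one h2]; exact hle
        · have hd : (x - v) 0 * (y - v) 1 = (x - v) 1 * (y - v) 0 := by
            rw [hfz, hfz] at he
            have : (α ^ 2 + β ^ 2) * ((x - v) 0 * (y - v) 1 - (x - v) 1 * (y - v) 0) = 0 := by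
              linear_combination -he
            rcases mul_eq_zero.1 this with h | h
            · exact absurd h hab.ne'
            · linarith
          ext i
          fin_cases i
          · simp only [Fin.zero_eta, PiLp.add_apply, PiLp.smul_apply, smul_eq_mul]
            field_simp
            rw [hfz, hfz]
            simp only [PiLp.sub_apply] at hd ⊢
            linear_combination -β * hd
          · simp only [Fin.mk_one, PiLp.add_apply, PiLp.smul_apply, smul_eq_mul]
            field_simp
            rw [hfz, hfz]
            simp only [PiLp.sub_apply] at hd ⊢
            linear_combination α * hd
      rw [← convexHull_pair] at hseg
      refine convexHull_mono ?_ hseg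
      simp only [Set.insert_subset_iff, Set.singleton_subset_iff, Set.mem_sdiff, Finset.mem_coe,
        Set.mem_singleton_iff]
      exact ⟨⟨hv, (Finset.ne_of_mem_erase hx).symm⟩, ⟨Finset.mem_of_mem_erase hy, hxy.symm⟩⟩
    rcases le_total (f (x - v)) (f (y - v)) with h | h
    · exact hray x hx y hy hne hxy h
    · exact hray y hy x hx (Ne.symm hne) hxy.symm h
  have hK : ((P.erase v).image κ).card = n - 1 := by
    rw [Finset.card_image_of_injOn hκinj, Finset.card_erase_of_mem hv, hcard]
  set e := ((P.erase v).image κ).orderEmbOfFin hK with he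
  have hex : ∀ i : Fin (n - 1), ∃ x ∈ P.erase v, κ x = e i := fun i =>
    Finset.mem_image.1 (Finset.orderEmbOfFin_mem _ hK i)
  choose q hq hqe using hex
  have hqsurj : ∀ x ∈ P.erase v, ∃ i, q i = x := by
    intro x hx
    have : κ x ∈ Set.range e := by
      rw [he, Finset.range_orderEmbOfFin]; exact Finset.mem_image_of_mem _ hx
    obtain ⟨i, hi⟩ := this
    exact ⟨i, hκinj (hq i) hx (by rw [hqe, hi])⟩
  have hqlt : ∀ i j : Fin (n - 1), i < j → κ (q i) < κ (q j) := by
    intro i j hij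
    rw [hqe, hqe]; exact e.strictMono hij
  set p : ℕ → Plane := fun i => if h : 1 ≤ i ∧ i < n then q ⟨i - 1, by omega⟩ else v with hp
  have hp0 : p 0 = v := by simp [hp]
  have hpn : p n = v := by simp [hp]
  have hpq : ∀ i, 1 ≤ i → i < n → p i ∈ P.erase v := by
    intro i h1 h2
    simp only [hp, h1, h2, and_self, dite_true]
    exact hq _
  have hplt : ∀ i j, 1 ≤ i → i < j → j < n → κ (p i) < κ (p j) := by
    intro i j h1 h2 h3
    have e1 : p i = q ⟨i - 1, by omega⟩ := by simp [hp, h1, h2.trans h3]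
    have e2 : p j = q ⟨j - 1, by omega⟩ := by simp [hp, h3, h1.trans h2.le]
    rw [e1, e2]
    exact hqlt _ _ (Fin.mk_lt_mk.2 (by omega))
  have hpv : ∀ i j, 1 ≤ i → i < j → j < n → 0 < signedArea v (p i) (p j) := fun i j h1 h2 h3 =>
    hlt _ (hpq i h1 (by omega)) _ (hpq j (by omega) h3) (hplt i j h1 h2 h3)
  have hpne : ∀ i j, 1 ≤ i → i < j → j < n → p i ≠ p j := fun i j h1 h2 h3 h4 => by
    have := hplt i j h1 h2 h3
    rw [h4] at this; exact lt_irrefl _ this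
  refine ⟨p, ⟨by rw [hpn, hp0], ?_, ?_, ?_, ?_⟩, hp0⟩
  · have key : ∀ i j, i < j → j < n → p i ≠ p j := by
      intro i j hij hj
      rcases Nat.eq_zero_or_pos i with rfl | h0
      · rw [hp0]; exact (Finset.ne_of_mem_erase (hpq j (by omega) hj)).symm
      · exact hpne i j h0 hij hj
    intro i hi j hj hij
    rcases lt_trichotomy i j with h | h | h
    · exact absurd hij (key i j h hj)
    · exact h
    · exact absurd hij.symm (key j i h hi)
  · intro i hi
    by_cases h : 1 ≤ i ∧ i < n
    · exact Finset.mem_of_mem_erase (hpq i h.1 h.2)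
    · simp only [hp, h, dite_false]; exact hv
  · intro x hx
    by_cases hxv : x = v
    · exact ⟨0, by omega, by rw [hp0, hxv]⟩
    · obtain ⟨i, rfl⟩ := hqsurj x (Finset.mem_erase.2 ⟨hxv, hx⟩)
      exact ⟨i + 1, by omega, by simp only [hp]; rw [dif_pos ⟨by omega, by omega⟩]; rfl⟩
  · intro i j k hij hjk hk hki
    rw [one_mul]
    rcases Nat.eq_zero_or_pos i with rfl | h0
    · rw [hp0]; exact hpv j k hij hjk (by omega)
    · rcases hk.eq_or_lt with rfl | hkn
      · rw [hpn, signedArea_rotate v]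
        exact hpv i j h0 hij hjk
      · exact hcol _ (hpq i h0 (by omega)) _ (hpq k (by omega) hkn) _ (hpq j (by omega) (by omega))
          (hpne i j h0 hij (by omega)) (hpne j k (by omega) hjk hkn).symm
          (hpv i k h0 (by omega) hkn) (hpv i j h0 hij (by omega)).le
          (hpv j k (by omega) hjk hkn).le

/-! ### The minimum enclosing circle -/

/-- The centre of the minimum enclosing circle lies in the convex hull of the contact points:
otherwise moving the centre towards them would shrink the circle. -/
lemma exists_minEnclosingCircle {P : Finset Plane} (hP : P.Nonempty) :
    ∃ (o : Plane) (R : ℝ), (∀ x ∈ P, dist x o ≤ R) ∧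
      o ∈ convexHull ℝ {x : Plane | x ∈ P ∧ dist x o = R} := by
  set F : Plane → ℝ := fun z => P.sup' hP (fun x => dist x z) with hF
  have hcont : Continuous F := by
    apply Continuous.finset_sup'_apply
    intro x _
    fun_prop
  obtain ⟨a, ha⟩ := hP
  have hcoer : Filter.Tendsto F (Filter.cocompact Plane) Filter.atTop := by
    refine Filter.tendsto_atTop_mono (fun z => ?_) (tendsto_dist_left_cocompact_atTop a)
    exact Finset.le_sup' (fun x => dist x z) ha
  obtain ⟨o, ho⟩ := hcont.exists_forall_le hcoer
  refine ⟨o, F o, fun x hx => Finset.le_sup' (fun x => dist x o) hx, ?_⟩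
  by_contra hnot
  set S : Set Plane := {x : Plane | x ∈ P ∧ dist x o = F o} with hS
  have hSfin : S.Finite := P.finite_toSet.subset fun x hx => hx.1
  obtain ⟨f, u, hfo, hfu⟩ := geometric_hahn_banach_point_closed (convex_convexHull ℝ S)
    (hSfin.isClosed_convexHull (𝕜 := ℝ)) hnot
  set d : Plane := (InnerProductSpace.toDual ℝ Plane).symm f with hd
  have hfd : ∀ z, f z = inner ℝ d z := fun z => by
    rw [hd, InnerProductSpace.toDual_symm_apply]
  have hev : ∀ x ∈ P, ∀ᶠ t : ℝ in nhdsWithin 0 (Set.Ioi 0), dist x (o + t • d) < F o := by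
    intro x hx
    rcases (Finset.le_sup' (fun x => dist x o) hx : dist x o ≤ F o).lt_or_eq with h | h
    · have hc : Continuous fun t : ℝ => dist x (o + t • d) := by fun_prop
      have : ∀ᶠ t : ℝ in nhds 0, dist x (o + t • d) < F o :=
        hc.continuousAt.eventually_lt continuousAt_const (by simpa using h)
      exact this.filter_mono nhdsWithin_le_nhds
    · have hpos : 0 < inner ℝ d (x - o) := by
        rw [← hfd, map_sub]
        have := hfu x (subset_convexHull _ _ ⟨hx, h⟩)
        linarith
      have hsmall : ∀ᶠ t : ℝ in nhds 0, t * ‖d‖ ^ 2 < 2 * inner ℝ d (x - o) := by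
        have hc : Continuous fun t : ℝ => t * ‖d‖ ^ 2 := by fun_prop
        exact hc.continuousAt.eventually_lt continuousAt_const (by simpa using hpos)
      filter_upwards [hsmall.filter_mono nhdsWithin_le_nhds, self_mem_nhdsWithin] with t ht ht0
      have ht0 : 0 < t := ht0
      refine lt_of_lt_of_eq ?_ h
      refine lt_of_pow_lt_pow_left₀ 2 dist_nonneg ?_
      have e : dist x (o + t • d) ^ 2
          = dist x o ^ 2 - t * (2 * inner ℝ d (x - o) - t * ‖d‖ ^ 2) := by
        simp only [plane_dist_sq, plane_inner, plane_norm_sq, PiLp.add_apply, PiLp.sub_apply,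
          PiLp.smul_apply, smul_eq_mul]
        ring
      rw [e]
      have := mul_pos ht0 (sub_pos.2 ht)
      linarith
  have hall : ∀ᶠ t : ℝ in nhdsWithin 0 (Set.Ioi 0), ∀ x ∈ P, dist x (o + t • d) < F o :=
    (Filter.eventually_all_finset P).2 hev
  obtain ⟨t, ht⟩ := hall.exists
  have : F (o + t • d) < F o := (Finset.sup'_lt_iff ⟨a, ha⟩).2 ht
  exact absurd (ho (o + t • d)) (not_le.2 this)

/-- At most three contact points suffice, and at least two are needed. -/
lemma exists_contact_points {P : Finset Plane} (hP : 2 ≤ P.card) :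
    ∃ (o : Plane) (R : ℝ), (∀ x ∈ P, dist x o ≤ R) ∧
      ((∃ a b, a ≠ b ∧ a ∈ P ∧ b ∈ P ∧ dist a o = R ∧ dist b o = R ∧
          o ∈ convexHull ℝ ({a, b} : Set Plane)) ∨
        ∃ a b c, a ≠ b ∧ a ≠ c ∧ b ≠ c ∧ a ∈ P ∧ b ∈ P ∧ c ∈ P ∧
          dist a o = R ∧ dist b o = R ∧ dist c o = R ∧
          o ∈ convexHull ℝ ({a, b, c} : Set Plane)) := by
  obtain ⟨o, R, hR, ho⟩ := exists_minEnclosingCircle (Finset.card_pos.1 (by omega : 0 < P.card))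
  rw [convexHull_eq_union] at ho
  simp only [Set.mem_iUnion] at ho
  obtain ⟨t, hts, hai, hot⟩ := ho
  refine ⟨o, R, hR, ?_⟩
  have hcard : t.card ≤ 3 := by
    have := hai.card_le_finrank_succ
    rw [Fintype.card_coe] at this
    have h2 := Submodule.finrank_le (vectorSpan ℝ (Set.range ((↑) : t → Plane)))
    rw [finrank_euclideanSpace_fin] at h2
    omega
  have h01 : t.card ≠ 0 := by
    intro h
    rw [Finset.card_eq_zero.1 h] at hot
    simp at hot
  have h1 : t.card ≠ 1 := by
    intro h
    obtain ⟨a, rfl⟩ := Finset.card_eq_one.1 h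
    simp only [Finset.coe_singleton, convexHull_singleton, Set.mem_singleton_iff] at hot
    have haR : dist a o = R := (hts (by simp)).2
    rw [hot, dist_self] at haR
    obtain ⟨x, hx, y, hy, hxy⟩ := Finset.one_lt_card.1 (show 1 < P.card by omega)
    refine hxy ?_
    rw [← haR] at hR
    rw [dist_le_zero.1 (hR x hx), dist_le_zero.1 (hR y hy)]
  have : t.card = 2 ∨ t.card = 3 := by omega
  rcases this with h | h
  · obtain ⟨a, b, hab, rfl⟩ := Finset.card_eq_two.1 h
    have ha := hts (show a ∈ (({a, b} : Finset Plane) : Set Plane) by simp)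
    have hb := hts (show b ∈ (({a, b} : Finset Plane) : Set Plane) by simp)
    exact Or.inl ⟨a, b, hab, ha.1, hb.1, ha.2, hb.2, by simpa using hot⟩
  · obtain ⟨a, b, c, hab, hac, hbc, rfl⟩ := Finset.card_eq_three.1 h
    have ha := hts (show a ∈ (({a, b, c} : Finset Plane) : Set Plane) by simp)
    have hb := hts (show b ∈ (({a, b, c} : Finset Plane) : Set Plane) by simp)
    have hc := hts (show c ∈ (({a, b, c} : Finset Plane) : Set Plane) by simp)
    exact Or.inr ⟨a, b, c, hab, hac, hbc, ha.1, hb.1, hc.1, ha.2, hb.2, hc.2, by simpa using hot⟩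

/-! ### Obtuse arcs of a convex polygon -/

/-- The sublist `p s, …, p e` is an obtuse arc: its points are distinct and all angles
`p i, p j, p k` with `s ≤ i < j < k ≤ e` are right or obtuse, expressed through squared
distances. -/
structure IsObtuseArc (p : ℕ → Plane) (s e : ℕ) : Prop where
  ne : ∀ i j, s ≤ i → i < j → j ≤ e → p i ≠ p j
  sq_add_sq_le : ∀ i j k, s ≤ i → i < j → j < k → k ≤ e →
    dist (p i) (p j) ^ 2 + dist (p j) (p k) ^ 2 ≤ dist (p i) (p k) ^ 2

lemma IsObtuseArc.reverse {p : ℕ → Plane} {n s e : ℕ} (h : IsObtuseArc p s e) (he : e ≤ n) :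
    IsObtuseArc (fun i => p (n - i)) (n - e) (n - s) where
  ne i j h1 h2 h3 := (h.ne (n - j) (n - i) (by omega) (by omega) (by omega)).symm
  sq_add_sq_le i j k h1 h2 h3 h4 := by
    have := h.sq_add_sq_le (n - k) (n - j) (n - i) (by omega) (by omega) (by omega) (by omega)
    simp only [dist_comm (p (n - i)), dist_comm (p (n - j)) (p (n - k))]
    linarith

lemma planeDet_self (u : Plane) : planeDet u u = 0 := by
  simp only [planeDet]; ring

lemma planeDet_sub_sub (a b c : Plane) : planeDet (a - c) (b - c) = signedArea c a b := rfl

section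
variable {P : Finset Plane} {n : ℕ} {σ : ℝ} {p : ℕ → Plane}

lemma IsPolygon.ne (h : IsPolygon P n σ p) {i j : ℕ} (hij : i < j) (hj : j ≤ n)
    (hji : j < i + n) : p i ≠ p j := by
  intro hp
  rcases hj.eq_or_lt with rfl | hjn
  · rw [h.closed] at hp
    have := h.inj i hij 0 (by omega) hp
    omega
  · have := h.inj i (by omega) j hjn hp
    omega

/-- If every interior point of the arc sees the two ends under a non-acute angle, then the arc is
obtuse: by convexity two points of the arc on either side are seen under a wider angle. -/
lemma IsPolygon.isObtuseArc (h : IsPolygon P n σ p) {s e : ℕ} (he : e ≤ n) (hes : e < s + n)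
    (hj : ∀ j, s < j → j < e → inner ℝ (p s - p j) (p e - p j) ≤ 0) : IsObtuseArc p s e := by
  refine ⟨fun i j h1 h2 h3 => h.ne h2 (by omega) (by omega), fun i j k h1 h2 h3 h4 => ?_⟩
  have hpos : ∀ i j k, s ≤ i → i < j → j < k → k ≤ e → 0 < σ * signedArea (p j) (p k) (p i) := by
    intro i j k h1 h2 h3 h4
    rw [signedArea_rotate]
    exact h.orient i j k h2 h3 (by omega) (by omega)
  refine dist_sq_add_le_of_inner_nonpos ?_
  have e1 : inner ℝ (p e - p j) (p i - p j) ≤ 0 := by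
    have := inner_le_of_turn (σ := σ) (c := 0) (u := p e - p j) (x := p s - p j) (y := p i - p j)
      (hpos s j e le_rfl (by omega) (by omega) le_rfl) ?_
      (hpos i j e h1 (by omega) (by omega) le_rfl) le_rfl ?_
    · simpa using this
    · rcases h1.eq_or_lt with rfl | hsi
      · simp [planeDet_self]
      · have := h.orient s i j hsi h2 (by omega) (by omega)
        rw [planeDet_sub_sub, ← signedArea_rotate (p j)]
        exact this.le
    · rw [zero_mul, real_inner_comm]; exact hj j (by omega) (by omega)
  have := inner_le_of_turn (σ := -σ) (c := 0) (u := p i - p j) (x := p e - p j) (y := p k - p j)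
      ?_ ?_ ?_ le_rfl ?_
  · simpa using this
  · have := hpos i j e h1 (by omega) (by omega) le_rfl
    rw [planeDet_sub_sub]
    simp only [signedArea_eq] at this ⊢; linarith
  · rcases h4.eq_or_lt with rfl | hke
    · simp [planeDet_self]
    · have := h.orient j k e h3 hke (by omega) (by omega)
      rw [planeDet_sub_sub]
      simp only [signedArea_eq] at this ⊢; linarith
  · have := hpos i j k h1 (by omega) (by omega) h4
    rw [planeDet_sub_sub]
    simp only [signedArea_eq] at this ⊢; linarith
  · rw [zero_mul, real_inner_comm]; exact e1

/-- An arc cut off by a chord of the enclosing circle, on the side away from the centre. -/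
lemma IsPolygon.isObtuseArc_of_chord (h : IsPolygon P n σ p) {s e : ℕ} {o : Plane} {R : ℝ}
    (he : e ≤ n) (hes : e < s + n) (hR : ∀ x ∈ P, dist x o ≤ R) (hs : dist (p s) o = R)
    (hee : dist (p e) o = R) (ho : 0 ≤ σ * signedArea (p s) (p e) o) : IsObtuseArc p s e := by
  refine h.isObtuseArc he hes fun j h1 h2 => ?_
  refine inner_nonpos_of_chord (σ := σ) (o := o) (by rw [hs, hee]) ?_ ho
    (h.orient s j e h1 h2 he hes)
  rw [hs]; exact hR _ (h.mem _ (by omega))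

/-- A bad edge has an apex on either side: two points of `P` on its bisector lie on different
sides of it, since otherwise the nearer one would be in the triangle formed by the edge and the
farther one. -/
lemma IsPolygon.exists_apex_of_not_isGood (h : IsPolygon P n σ p) {i j : ℕ} (hij : i < j)
    (hj : j ≤ n) (hji : j < i + n) (hbad : ¬ IsGood P (p i) (p j)) :
    (∃ k, i < k ∧ k < j ∧ dist (p k) (p i) = dist (p k) (p j)) ∧
      ∃ l, l < n ∧ (l < i ∨ j < l) ∧ dist (p l) (p i) = dist (p l) (p j) := by
  obtain ⟨x, hx, y, hy, hxy⟩ := Set.not_subsingleton_iff.1 hbad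
  obtain ⟨hxP, hx⟩ := hx
  obtain ⟨hyP, hy⟩ := hy
  rw [SetLike.mem_coe, AffineSubspace.mem_perpBisector_iff_dist_eq] at hx hy
  obtain ⟨k, hk, rfl⟩ := h.surj x hxP
  obtain ⟨l, hl, rfl⟩ := h.surj y hyP
  have hne := h.ne hij hj hji
  have hoff : ∀ k, k < n → dist (p k) (p i) = dist (p k) (p j) →
      k ≠ i ∧ k ≠ j ∧ (k = 0 → j ≠ n) := by
    intro k _ hk
    have hi : p k ≠ p i := by
      intro e; rw [e, dist_self, eq_comm, dist_eq_zero] at hk; exact hne hk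
    have hj : p k ≠ p j := by
      intro e; rw [e, dist_self, dist_eq_zero] at hk; exact hne hk.symm
    refine ⟨fun e => hi (by rw [e]), fun e => hj (by rw [e]), fun e e' => hj ?_⟩
    rw [e, e', h.closed]
  have hquad : ∀ {a b c d : ℕ}, c < d →
      (a < b ∧ b < c ∧ d ≤ n ∧ d < a + n ∨ d < a ∧ a < b ∧ b ≤ n ∧ b < c + n ∨
        b < c ∧ d < a ∧ a ≤ n ∧ a < b + n) →
      dist (p c) (p a) = dist (p c) (p b) → dist (p d) (p a) = dist (p d) (p b) → False := by
    intro a b c d hcd hc e1 e2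
    refine dist_ne_of_convex_quadrilateral (σ := σ) (x := p a) (y := p b) (b := p c) (v := p d)
      ?_ ?_ ?_ e2.ge e1
    all_goals rcases hc with hc | hc | hc
    · exact h.orient _ _ _ (by omega) (by omega) (by omega) (by omega)
    · rw [← signedArea_rotate]
      exact h.orient _ _ _ (by omega) (by omega) (by omega) (by omega)
    · exact h.orient _ _ _ (by omega) (by omega) (by omega) (by omega)
    · exact h.orient _ _ _ (by omega) (by omega) (by omega) (by omega)
    · rw [← signedArea_rotate]
      exact h.orient _ _ _ (by omega) (by omega) (by omega) (by omega)
    · rw [← signedArea_rotate]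
      exact h.orient _ _ _ (by omega) (by omega) (by omega) (by omega)
    · exact h.orient _ _ _ (by omega) (by omega) (by omega) (by omega)
    · rw [signedArea_rotate]
      exact h.orient _ _ _ (by omega) (by omega) (by omega) (by omega)
    · rw [← signedArea_rotate]
      exact h.orient _ _ _ (by omega) (by omega) (by omega) (by omega)
  have hsplit : ∀ k l, k < l → l < n → dist (p k) (p i) = dist (p k) (p j) →
      dist (p l) (p i) = dist (p l) (p j) →
      (∃ k, i < k ∧ k < j ∧ dist (p k) (p i) = dist (p k) (p j)) ∧
      ∃ l, l < n ∧ (l < i ∨ j < l) ∧ dist (p l) (p i) = dist (p l) (p j) := by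
    intro k l hkl hl hk' hl'
    have o1 := hoff k (by omega) hk'
    have o2 := hoff l hl hl'
    rcases lt_or_gt_of_ne o1.1 with a1 | a1
    · rcases lt_or_gt_of_ne o2.1 with b1 | b1
      · exact (hquad hkl (Or.inr (Or.inl ⟨b1, hij, hj, by omega⟩)) hk' hl').elim
      · rcases lt_or_gt_of_ne o2.2.1 with b2 | b2
        · exact ⟨⟨l, b1, b2, hl'⟩, k, by omega, Or.inl a1, hk'⟩
        · -- the order around the polygon is `k, i, j, l`
          refine (dist_ne_of_convex_quadrilateral (σ := σ) (x := p i) (y := p j) (b := p l)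
            (v := p k) ?_ ?_ ?_ hk'.ge hl').elim
          · rw [signedArea_rotate]
            exact h.orient _ _ _ (by omega) (by omega) (by omega) (by omega)
          · rw [signedArea_rotate]
            exact h.orient _ _ _ (by omega) (by omega) (by omega) (by omega)
          · exact h.orient _ _ _ (by omega) (by omega) (by omega) (by omega)
    · rcases lt_or_gt_of_ne o1.2.1 with a2 | a2
      · rcases lt_or_gt_of_ne o2.2.1 with b2 | b2
        · exact (hquad (a := j) (b := i) hkl (Or.inr (Or.inr ⟨a1, b2, hj, hji⟩))
            hk'.symm hl'.symm).elim
        · exact ⟨⟨k, a1, a2, hk'⟩, l, hl, Or.inr b2, hl'⟩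
      · exact (hquad hkl (Or.inl ⟨hij, a2, hl.le, by omega⟩) hk' hl').elim
  rcases lt_trichotomy k l with hkl | hkl | hkl
  · exact hsplit k l hkl hl hx hy
  · exact absurd (by rw [hkl]) hxy
  · exact hsplit l k hkl hk hy hx

/-- Chords from one vertex to the two arcs at it are seen under a wide angle if the triangle of
contact points has a wide angle at that vertex. -/
lemma IsPolygon.inner_le_of_corner (h : IsPolygon P n σ p) {α β s j : ℕ} (h1 : 1 ≤ s)
    (h2 : s ≤ α) (h3 : α < β) (h4 : β ≤ j) (h5 : j < n) {c : ℝ} (hc : 0 ≤ c)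
    (hang : inner ℝ (p α - p 0) (p β - p 0) ≤ c * (‖p α - p 0‖ * ‖p β - p 0‖)) :
    inner ℝ (p s - p 0) (p j - p 0) ≤ c * (‖p s - p 0‖ * ‖p j - p 0‖) := by
  have hpos : ∀ i k, 1 ≤ i → i < k → k < n → 0 < σ * planeDet (p i - p 0) (p k - p 0) :=
    fun i k h1 h2 h3 => h.orient 0 i k h1 h2 h3.le (by omega)
  have hneg : ∀ i k, 1 ≤ i → i < k → k < n → 0 < -σ * planeDet (p k - p 0) (p i - p 0) := by
    intro i k h1 h2 h3
    have := hpos i k h1 h2 h3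
    simp only [planeDet] at this ⊢; linarith
  have e1 : inner ℝ (p α - p 0) (p j - p 0) ≤ c * (‖p α - p 0‖ * ‖p j - p 0‖) := by
    refine inner_le_of_turn (σ := σ) (hpos α β (by omega) h3 (by omega)) ?_
      (hpos α j (by omega) (by omega) h5) hc hang
    rcases h4.eq_or_lt with rfl | hlt
    · simp [planeDet_self]
    · exact (hpos β j (by omega) hlt h5).le
  rw [real_inner_comm, mul_comm ‖p s - p 0‖]
  refine inner_le_of_turn (σ := -σ) (hneg α j (by omega) (by omega) h5) ?_
      (hneg s j (by omega) (by omega) h5) hc (by rw [real_inner_comm, mul_comm ‖p j - p 0‖]; exact e1)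
  rcases h2.eq_or_lt with rfl | hlt
  · simp [planeDet_self]
  · exact (hneg s α h1 hlt (by omega)).le

end

/-! ### Isosceles triangles inside an obtuse arc -/

namespace IsObtuseArc
variable {p : ℕ → Plane} {s e : ℕ}

lemma dist_lt_right (h : IsObtuseArc p s e) {i j k : ℕ} (h1 : s ≤ i) (h2 : i < j) (h3 : j < k)
    (h4 : k ≤ e) : dist (p i) (p j) < dist (p i) (p k) := by
  have h5 := h.sq_add_sq_le i j k h1 h2 h3 h4
  have h6 := dist_pos.2 (h.ne j k (by omega) h3 h4)
  exact lt_of_pow_lt_pow_left₀ 2 dist_nonneg (by nlinarith)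

lemma dist_lt_left (h : IsObtuseArc p s e) {i j k : ℕ} (h1 : s ≤ i) (h2 : i < j) (h3 : j < k)
    (h4 : k ≤ e) : dist (p k) (p j) < dist (p k) (p i) := by
  have h5 := h.sq_add_sq_le i j k h1 h2 h3 h4
  have h6 := dist_pos.2 (h.ne i j h1 h2 (by omega))
  rw [dist_comm (p k), dist_comm (p k)]
  exact lt_of_pow_lt_pow_left₀ 2 dist_nonneg (by nlinarith)

lemma right_unique (h : IsObtuseArc p s e) {k i j : ℕ} (hk : s ≤ k) (hi : k < i) (hj : k < j)
    (hie : i ≤ e) (hje : j ≤ e) (heq : dist (p k) (p i) = dist (p k) (p j)) : i = j := by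
  rcases lt_trichotomy i j with hlt | hlt | hlt
  · exact absurd heq (h.dist_lt_right hk hi hlt hje).ne
  · exact hlt
  · exact absurd heq (h.dist_lt_right hk hj hlt hie).ne'

lemma left_unique (h : IsObtuseArc p s e) {k i j : ℕ} (hk : k ≤ e) (hi : i < k) (hj : j < k)
    (hie : s ≤ i) (hje : s ≤ j) (heq : dist (p k) (p i) = dist (p k) (p j)) : i = j := by
  rcases lt_trichotomy i j with hlt | hlt | hlt
  · exact absurd heq (h.dist_lt_left hie hlt hj hk).ne'
  · exact hlt
  · exact absurd heq (h.dist_lt_left hje hlt hi hk).ne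

end IsObtuseArc

open Classical in
/-- The indices `i` before `k` in the arc from `s` to `e` for which some later point of the arc is
as far from `p k` as `p i` is. -/
noncomputable def matchedSet (p : ℕ → Plane) (s e k : ℕ) : Finset ℕ :=
  (Finset.Ico s k).filter fun i => ∃ j, k < j ∧ j ≤ e ∧ dist (p k) (p i) = dist (p k) (p j)

lemma mem_matchedSet {p : ℕ → Plane} {s e k i : ℕ} : i ∈ matchedSet p s e k ↔
    (s ≤ i ∧ i < k) ∧ ∃ j, k < j ∧ j ≤ e ∧ dist (p k) (p i) = dist (p k) (p j) := by
  simp [matchedSet]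

/-- How far `matchedSet p s e k` is from its largest conceivable size. -/
noncomputable def matchDefect (p : ℕ → Plane) (s e k : ℕ) : ℕ :=
  min (k - s) (e - k) - (matchedSet p s e k).card

/-- The index pairs `i < j` in the interval from `s` to `e`. -/
def arcPairs (s e : ℕ) : Finset (ℕ × ℕ) :=
  (Finset.Icc s e ×ˢ Finset.Icc s e).filter fun x => x.1 < x.2

lemma mem_arcPairs {s e : ℕ} {x : ℕ × ℕ} :
    x ∈ arcPairs s e ↔ s ≤ x.1 ∧ x.1 < x.2 ∧ x.2 ≤ e := by
  simp only [arcPairs, Finset.mem_filter, Finset.mem_product, Finset.mem_Icc]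
  omega

lemma two_mul_card_arcPairs (s N : ℕ) : 2 * (arcPairs s (s + N)).card = N * (N + 1) := by
  have h : (arcPairs s (s + N)).card = ∑ j ∈ Finset.Icc s (s + N), (j - s) := by
    rw [Finset.card_eq_sum_card_fiberwise (f := Prod.snd) (t := Finset.Icc s (s + N))]
    · refine Finset.sum_congr rfl fun j hj => ?_
      rw [← Nat.card_Ico s j]
      refine Finset.card_bij (fun x _ => x.1) ?_ ?_ ?_
      · intro x hx
        simp only [Finset.mem_filter, mem_arcPairs] at hx
        rw [Finset.mem_Ico]; omega
      · rintro ⟨a, b⟩ hx ⟨c, d⟩ hy hxy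
        simp only [Finset.mem_filter] at hx hy
        simp only at hxy
        rw [Prod.mk.injEq]; exact ⟨hxy, hx.2.trans hy.2.symm⟩
      · intro i hi
        rw [Finset.mem_Ico] at hi
        rw [Finset.mem_Icc] at hj
        exact ⟨(i, j), by simp [mem_arcPairs]; omega, rfl⟩
    · intro x hx
      have := mem_arcPairs.1 hx
      simp only [Finset.coe_Icc, Set.mem_Icc]; omega
  have h2 : ∑ j ∈ Finset.Icc s (s + N), (j - s) = ∑ j ∈ Finset.range (N + 1), j := by
    rw [← Finset.Ico_add_one_right_eq_Icc, Finset.sum_Ico_eq_sum_range]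
    refine Finset.sum_congr (by congr 1; omega) fun j _ => by omega
  have := Finset.sum_range_id_mul_two (N + 1)
  rw [h, h2, mul_comm, this]; simp [mul_comm]

lemma four_mul_sum_min_le : ∀ N : ℕ, 4 * ∑ k ∈ Finset.range (N + 1), min k (N - k) ≤ N ^ 2
  | 0 => by simp
  | 1 => by simp [Finset.sum_range_succ]
  | N + 2 => by
    have ih := four_mul_sum_min_le N
    rw [Finset.sum_range_succ, Finset.sum_range_succ']
    have : ∑ k ∈ Finset.range (N + 1), min (k + 1) (N + 2 - (k + 1))
        = ∑ k ∈ Finset.range (N + 1), min k (N - k) + (N + 1) := by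
      have h1 : ∀ k ∈ Finset.range (N + 1), min (k + 1) (N + 2 - (k + 1)) = min k (N - k) + 1 := by
        intro k hk
        have := Finset.mem_range.1 hk
        omega
      rw [Finset.sum_congr rfl h1, Finset.sum_add_distrib]
      simp
    rw [this]
    simp
    nlinarith

section
variable {p : ℕ → Plane} {s e : ℕ}

lemma card_matchedSet_le (h : IsObtuseArc p s e) (k : ℕ) :
    (matchedSet p s e k).card ≤ min (k - s) (e - k) := by
  refine le_min ?_ ?_
  · rw [← Nat.card_Ico]
    exact Finset.card_le_card fun i hi => Finset.mem_Ico.2 (mem_matchedSet.1 hi).1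
  · rw [← Nat.card_Ioc]
    have hex : ∀ i ∈ matchedSet p s e k, ∃ j, k < j ∧ j ≤ e ∧ dist (p k) (p i) = dist (p k) (p j) :=
      fun i hi => (mem_matchedSet.1 hi).2
    choose! f hf using hex
    refine Finset.card_le_card_of_injOn f ?_ ?_
    · intro i hi
      have := hf i hi
      simp only [Finset.coe_Ioc, Set.mem_Ioc]; omega
    · intro i hi j hj hij
      have h1 := hf i hi
      have h2 := hf j hj
      have m1 := (mem_matchedSet.1 hi).1
      have m2 := (mem_matchedSet.1 hj).1
      refine h.left_unique (k := k) (by omega) (by omega) (by omega) m1.1 m2.1 ?_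
      rw [h1.2.2, h2.2.2, hij]

lemma card_matchedSet_add_matchDefect (h : IsObtuseArc p s e) (k : ℕ) :
    (matchedSet p s e k).card + matchDefect p s e k = min (k - s) (e - k) := by
  have := card_matchedSet_le h k
  unfold matchDefect; omega

open Classical in
/-- About half of the pairs in an obtuse arc are good, and every defect of a matching adds one:
a bad pair has an apex inside the arc, and the apex and the first point determine the second. -/
lemma card_good_arcPairs {N : ℕ} (h : IsObtuseArc p s (s + N)) {good : ℕ → ℕ → Prop}
    (hbad : ∀ i j, s ≤ i → i < j → j ≤ s + N → ¬ good i j →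
      ∃ k, i < k ∧ k < j ∧ dist (p k) (p i) = dist (p k) (p j)) :
    N * (N + 2) + 4 * ∑ k ∈ Finset.range (N + 1), matchDefect p s (s + N) (s + k)
      ≤ 4 * ((arcPairs s (s + N)).filter fun x => good x.1 x.2).card := by
  have hB : ((arcPairs s (s + N)).filter fun x => ¬ good x.1 x.2).card
      ≤ ∑ k ∈ Finset.range (N + 1), (matchedSet p s (s + N) (s + k)).card := by
    rw [← Finset.card_sigma]
    have hex : ∀ x ∈ (arcPairs s (s + N)).filter fun x => ¬ good x.1 x.2,
        ∃ k, x.1 < k ∧ k < x.2 ∧ dist (p k) (p x.1) = dist (p k) (p x.2) := by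
      intro x hx
      obtain ⟨hx, hg⟩ := Finset.mem_filter.1 hx
      have := mem_arcPairs.1 hx
      exact hbad _ _ this.1 this.2.1 this.2.2 hg
    choose! f hf using hex
    refine Finset.card_le_card_of_injOn (fun x => ⟨f x - s, x.1⟩) ?_ ?_
    · intro x hx
      have h1 := hf x hx
      have h2 := mem_arcPairs.1 (Finset.mem_filter.1 hx).1
      have h3 : s + (f x - s) = f x := by omega
      simp only [Finset.coe_sigma, Set.mem_sigma_iff, Finset.mem_coe, Finset.mem_range,
        mem_matchedSet, h3]
      exact ⟨by omega, ⟨h2.1, h1.1⟩, x.2, h1.2.1, h2.2.2, h1.2.2⟩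
    · intro x hx y hy hxy
      have h1 := hf x hx
      have h2 := mem_arcPairs.1 (Finset.mem_filter.1 hx).1
      have h3 := hf y hy
      have h4 := mem_arcPairs.1 (Finset.mem_filter.1 hy).1
      simp only [Sigma.mk.injEq, heq_eq_eq] at hxy
      have h5 : f x = f y := by omega
      refine Prod.ext hxy.2 (h.right_unique (k := f x) (by omega) h1.2.1 (by omega) h2.2.2 h4.2.2 ?_)
      rw [← h1.2.2, h5, ← h3.2.2, hxy.2]
  have hsum : ∑ k ∈ Finset.range (N + 1), (matchedSet p s (s + N) (s + k)).card
      + ∑ k ∈ Finset.range (N + 1), matchDefect p s (s + N) (s + k)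
      = ∑ k ∈ Finset.range (N + 1), min k (N - k) := by
    rw [← Finset.sum_add_distrib]
    refine Finset.sum_congr rfl fun k _ => ?_
    rw [card_matchedSet_add_matchDefect h (s + k)]
    congr 1 <;> omega
  have hmin := four_mul_sum_min_le N
  have htot := two_mul_card_arcPairs s N
  have hsplit := Finset.card_filter_add_card_filter_not (s := arcPairs s (s + N))
    (fun x => good x.1 x.2)
  have hsq : N * (N + 2) + N ^ 2 = 2 * (N * (N + 1)) := by ring
  omega

end

/-! ### Apexes of edges that leave an obtuse arc -/

section
variable {p : ℕ → Plane} {N : ℕ}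

/-- The partners of the matched points before `p q` are at most as far from `p q` as `p 0` is; as
distances increase along the arc, so are the points that directly follow `p q`, as many as there are
partners. -/
lemma dist_le_of_le_add_card (h : IsObtuseArc p 0 N) {q t : ℕ} (hqt : q < t)
    (ht : t ≤ q + (matchedSet p 0 N q).card) : dist (p q) (p t) ≤ dist (p q) (p 0) := by
  have hle := card_matchedSet_le h q
  by_contra! hlt
  have hex : ∀ i ∈ matchedSet p 0 N q, ∃ j, q < j ∧ j ≤ N ∧ dist (p q) (p i) = dist (p q) (p j) :=
    fun i hi => (mem_matchedSet.1 hi).2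
  choose! f hf using hex
  have hcard : (matchedSet p 0 N q).card ≤ (Finset.Ioo q t).card := by
    refine Finset.card_le_card_of_injOn f ?_ ?_
    · intro i hi
      have h1 := hf i hi
      have m1 := (mem_matchedSet.1 hi).1
      simp only [Finset.coe_Ioo, Set.mem_Ioo]
      refine ⟨h1.1, ?_⟩
      by_contra! hti
      have e1 : dist (p q) (p t) ≤ dist (p q) (p (f i)) := by
        rcases hti.eq_or_lt with e | hti
        · rw [e]
        · exact (h.dist_lt_right (Nat.zero_le _) hqt hti h1.2.1).le
      have e2 : dist (p q) (p i) ≤ dist (p q) (p 0) := by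
        rcases (Nat.zero_le i).eq_or_lt with e | hi0
        · rw [e]
        · exact (h.dist_lt_left le_rfl hi0 m1.2 (by omega)).le
      linarith [h1.2.2]
    · intro i hi j hj hij
      have h1 := hf i hi
      have h2 := hf j hj
      have m1 := (mem_matchedSet.1 hi).1
      have m2 := (mem_matchedSet.1 hj).1
      refine h.left_unique (k := q) (by omega) (by omega) (by omega) m1.1 m2.1 ?_
      rw [h1.2.2, h2.2.2, hij]
  rw [Nat.card_Ioo] at hcard
  omega

/-- If `p r` is not much closer to `p t` than `p 0` is, then `r` exceeds `t` substantially: with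
`q` about `t / 2`, the points between `p q` and `p t` are closer to `p t` than `p r` is, and the
matched ones among them have partners between `p t` and `p r`. -/
lemma add_card_matchedSet_le (h : IsObtuseArc p 0 N) {q t r : ℕ} (hqt : q < t) (htr : t < r)
    (hr : r ≤ N) (ht : t ≤ q + (matchedSet p 0 N q).card)
    (hd : dist (p t) (p 0) ^ 2 ≤ 2 * dist (p t) (p r) ^ 2) :
    t + (matchedSet p 0 N t).card ≤ r + q := by
  have hq0 : 0 < q := by
    have := card_matchedSet_le h q
    omega
  have hdq : dist (p t) (p q) ≤ dist (p t) (p r) := by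
    have h1 := dist_le_of_le_add_card h hqt ht
    have h2 := h.sq_add_sq_le 0 q t le_rfl hq0 hqt (by omega)
    rw [dist_comm (p q) (p 0)] at h1
    have h3 : dist (p q) (p t) ^ 2 ≤ dist (p 0) (p q) ^ 2 := pow_le_pow_left₀ dist_nonneg h1 2
    rw [dist_comm (p t) (p 0)] at hd
    rw [dist_comm (p t) (p q)]
    exact (pow_le_pow_iff_left₀ dist_nonneg dist_nonneg two_ne_zero).1 (by linarith)
  have hex : ∀ i ∈ matchedSet p 0 N t, ∃ j, t < j ∧ j ≤ N ∧ dist (p t) (p i) = dist (p t) (p j) :=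
    fun i hi => (mem_matchedSet.1 hi).2
  choose! f hf using hex
  have hcard : (matchedSet p 0 N t \ Finset.range q).card ≤ (Finset.Ioc t r).card := by
    refine Finset.card_le_card_of_injOn f ?_ ?_
    · intro i hi
      obtain ⟨hi, hiq⟩ := Finset.mem_sdiff.1 hi
      have h1 := hf i hi
      have m1 := (mem_matchedSet.1 hi).1
      rw [Finset.mem_range, not_lt] at hiq
      simp only [Finset.coe_Ioc, Set.mem_Ioc]
      refine ⟨h1.1, ?_⟩
      by_contra! hti
      have e1 := h.dist_lt_right (Nat.zero_le _) htr hti h1.2.1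
      have e2 : dist (p t) (p i) ≤ dist (p t) (p q) := by
        rcases hiq.eq_or_lt with e | hi0
        · rw [e]
        · exact (h.dist_lt_left (Nat.zero_le _) hi0 m1.2 (by omega)).le
      linarith [h1.2.2]
    · intro i hi j hj hij
      have hi := (Finset.mem_sdiff.1 hi).1
      have hj := (Finset.mem_sdiff.1 hj).1
      have h1 := hf i hi
      have h2 := hf j hj
      have m1 := (mem_matchedSet.1 hi).1
      have m2 := (mem_matchedSet.1 hj).1
      refine h.left_unique (k := t) (by omega) (by omega) (by omega) m1.1 m2.1 ?_
      rw [h1.2.2, h2.2.2, hij]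
  have := Finset.le_card_sdiff (Finset.range q) (matchedSet p 0 N t)
  rw [Finset.card_range] at this
  rw [Nat.card_Ioc] at hcard
  omega

end

lemma card_mul_card_add_one_le {a : ℕ} (T : Finset ℕ) (hT : ∀ t ∈ T, a < t) :
    T.card * (T.card + 1) ≤ 2 * ∑ t ∈ T, (t - a) := by
  induction T using Finset.induction_on_max with
  | empty => simp
  | insert m s hm ih =>
    have hms : m ∉ s := fun h => lt_irrefl _ (hm m h)
    rw [Finset.card_insert_of_notMem hms, Finset.sum_insert hms]
    have ih := ih fun t ht => hT t (Finset.mem_insert_of_mem ht)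
    have hc : s.card ≤ (Finset.Ioo a m).card := Finset.card_le_card fun t ht =>
      Finset.mem_Ioo.2 ⟨hT t (Finset.mem_insert_of_mem ht), hm t ht⟩
    have := hT m (Finset.mem_insert_self _ _)
    rw [Nat.card_Ioo] at hc
    have : s.card + 1 ≤ m - a := by omega
    nlinarith

/-- A small total defect `∑ D` bounds the number of possible apexes: for `t` beyond
`a ≈ 2 (L + h) / 3` the defect of `t` is at least `3 (t - a) / 2`. -/
lemma exists_card_le_of_defect {L h a : ℕ} {M D : ℕ → ℕ} (hMD : ∀ t < L, M t + D t = t)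
    (hD : ∑ t ∈ Finset.range L, D t < h * (h + 1)) (ha : 2 * L + 2 * h ≤ 3 * a)
    (S : Finset ℕ) (hSL : ∀ t ∈ S, t < L)
    (hS : ∀ t ∈ S, ∀ q < t, t ≤ q + M q → t + M t ≤ L + q) :
    ∃ K, S.card ≤ a + 1 + K ∧ 3 * (K * (K + 1)) ≤ 4 * ∑ t ∈ Finset.range L, D t := by
  have hex : ∀ t, a < t → t < L → ∃ q, q < t ∧ q ≤ t / 2 + h ∧ t ≤ q + M q := by
    intro t hat htL
    by_contra! hno
    have h1 : ∑ i ∈ Finset.range h, D (t / 2 + 1 + i) ≤ ∑ t ∈ Finset.range L, D t := by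
      have : ∑ i ∈ Finset.range h, D (t / 2 + 1 + i)
          = ∑ q ∈ Finset.Ico (t / 2 + 1) (t / 2 + 1 + h), D q := by
        rw [Finset.sum_Ico_eq_sum_range]; simp
      rw [this]
      refine Finset.sum_le_sum_of_subset fun q hq => ?_
      rw [Finset.mem_Ico] at hq
      rw [Finset.mem_range]; omega
    have h2 : ∑ i ∈ Finset.range h, (2 * (i + 1)) ≤ ∑ i ∈ Finset.range h, D (t / 2 + 1 + i) := by
      refine Finset.sum_le_sum fun i hi => ?_
      rw [Finset.mem_range] at hi
      have := hno (t / 2 + 1 + i) (by omega) (by omega)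
      have := hMD (t / 2 + 1 + i) (by omega)
      omega
    have h3 : ∑ i ∈ Finset.range h, (2 * (i + 1)) = h * (h + 1) := by
      have := Finset.sum_range_id_mul_two (h + 1)
      rw [Finset.sum_range_succ'] at this
      rw [← Finset.mul_sum]
      simp only [Nat.add_sub_cancel, add_zero] at this
      linarith
    omega
  refine ⟨(S.filter (a < ·)).card, ?_, ?_⟩
  · rw [← Finset.card_filter_add_card_filter_not (s := S) (a < ·)]
    have : (S.filter fun t => ¬ a < t).card ≤ (Finset.range (a + 1)).card :=
      Finset.card_le_card fun t ht => by
        rw [Finset.mem_filter] at ht; rw [Finset.mem_range]; omega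
    rw [Finset.card_range] at this
    omega
  · have h1 := card_mul_card_add_one_le (S.filter (a < ·)) fun t ht => (Finset.mem_filter.1 ht).2
    have h2 : ∑ t ∈ S.filter (a < ·), 3 * (t - a) ≤ ∑ t ∈ S.filter (a < ·), 2 * D t := by
      refine Finset.sum_le_sum fun t ht => ?_
      obtain ⟨htS, hat⟩ := Finset.mem_filter.1 ht
      obtain ⟨q, hqt, hqh, htq⟩ := hex t hat (hSL t htS)
      have := hS t htS q hqt htq
      have := hMD t (hSL t htS)
      omega
    have h3 : ∑ t ∈ S.filter (a < ·), D t ≤ ∑ t ∈ Finset.range L, D t :=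
      Finset.sum_le_sum_of_subset fun t ht =>
        Finset.mem_range.2 (hSL t (Finset.mem_filter.1 ht).1)
    rw [← Finset.mul_sum, ← Finset.mul_sum] at h2
    omega

/-! ### Good edges that leave an obtuse arc -/

open Classical in
/-- Among the pairs of a point `p r` of an obtuse arc, `l < r ≤ L`, and a point of a set `Y` seen
from the arc's end `p 0` under a wide angle, a bad pair has its apex on the arc before `p r`.
There are few possible apexes, and the apex and the point of `Y` determine `r`. -/
lemma card_good_cross {p : ℕ → Plane} {N L l h a : ℕ} (hA : IsObtuseArc p 0 N) (hLN : 2 * L ≤ N)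
    (hD : ∑ t ∈ Finset.range L, matchDefect p 0 N t < h * (h + 1))
    (ha : 2 * L + 2 * h ≤ 3 * a) (Y : Finset ℕ) {good : ℕ → ℕ → Prop}
    (hapex : ∀ r y, l < r → r ≤ L → y ∈ Y → ¬ good r y →
      ∃ t < r, dist (p t) (p r) = dist (p t) (p y))
    (hwide : ∀ t y, 1 ≤ t → t ≤ L → y ∈ Y → dist (p t) (p 0) ^ 2 ≤ 2 * dist (p t) (p y) ^ 2) :
    ∃ K, (L - l) * Y.card ≤ ((Finset.Ioc l L ×ˢ Y).filter fun x => good x.1 x.2).card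
        + (a + 2 + K) * Y.card ∧
      3 * (K * (K + 1)) ≤ 4 * ∑ t ∈ Finset.range L, matchDefect p 0 N t := by
  set S := (Finset.range L).filter fun t => 1 ≤ t ∧
    ∃ r ≤ L, t < r ∧ dist (p t) (p 0) ^ 2 ≤ 2 * dist (p t) (p r) ^ 2 with hS
  obtain ⟨K, hK, hKD⟩ := exists_card_le_of_defect (M := fun t => (matchedSet p 0 N t).card)
    (D := matchDefect p 0 N) (fun t ht => by
      rw [card_matchedSet_add_matchDefect hA]; omega) hD ha S
    (fun t ht => Finset.mem_range.1 (Finset.mem_filter.1 ht).1) (fun t ht q hq htq => by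
      obtain ⟨_, _, r, hr, htr, hd⟩ := Finset.mem_filter.1 ht
      have := add_card_matchedSet_le hA hq htr (by omega) htq hd
      omega)
  refine ⟨K, ?_, hKD⟩
  have hbad : ((Finset.Ioc l L ×ˢ Y).filter fun x => ¬ good x.1 x.2).card
      ≤ (insert 0 S ×ˢ Y).card := by
    have hex : ∀ x ∈ (Finset.Ioc l L ×ˢ Y).filter fun x => ¬ good x.1 x.2,
        ∃ t < x.1, dist (p t) (p x.1) = dist (p t) (p x.2) := by
      intro x hx
      obtain ⟨hx, hg⟩ := Finset.mem_filter.1 hx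
      obtain ⟨h1, h2⟩ := Finset.mem_product.1 hx
      rw [Finset.mem_Ioc] at h1
      exact hapex _ _ h1.1 h1.2 h2 hg
    choose! f hf using hex
    refine Finset.card_le_card_of_injOn (fun x => (f x, x.2)) ?_ ?_
    · intro x hx
      have h1 := hf x hx
      obtain ⟨h2, h3⟩ := Finset.mem_product.1 (Finset.mem_filter.1 hx).1
      rw [Finset.mem_Ioc] at h2
      simp only [Finset.coe_product, Set.mem_prod, Finset.mem_coe, Finset.mem_insert]
      refine ⟨?_, h3⟩
      rcases Nat.eq_zero_or_pos (f x) with h0 | h0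
      · exact Or.inl h0
      · refine Or.inr (Finset.mem_filter.2 ⟨Finset.mem_range.2 (by omega), h0, x.1, h2.2, h1.1, ?_⟩)
        rw [h1.2]
        exact hwide _ _ h0 (by omega) h3
    · intro x hx y hy hxy
      have h1 := hf x hx
      have h2 := hf y hy
      have h3 := (Finset.mem_product.1 (Finset.mem_filter.1 hx).1).1
      have h4 := (Finset.mem_product.1 (Finset.mem_filter.1 hy).1).1
      rw [Finset.mem_Ioc] at h3 h4
      simp only [Prod.mk.injEq] at hxy
      refine Prod.ext (hA.right_unique (Nat.zero_le (f x)) h1.1 (by omega) (by omega) (by omega) ?_)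
        hxy.2
      rw [h1.2, hxy.1, h2.2, hxy.2]
  have htot := Finset.card_filter_add_card_filter_not (s := Finset.Ioc l L ×ˢ Y)
    (fun x => good x.1 x.2)
  rw [Finset.card_product, Nat.card_Ioc] at htot
  rw [Finset.card_product] at hbad
  have h0 : (insert 0 S).card ≤ a + 2 + K := (Finset.card_insert_le _ _).trans (by omega)
  have := Nat.mul_le_mul_right Y.card h0
  omega

/-! ### Counting good edges -/

lemma goodEdges_finite (P : Finset Plane) : (goodEdges P).Finite := by
  refine ((P ×ˢ P).finite_toSet.image fun x => s(x.1, x.2)).subset ?_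
  rintro _ ⟨a, ha, b, hb, -, -, rfl⟩
  exact ⟨(a, b), by simp [ha, hb], rfl⟩

/-- Good index pairs give distinct good edges; as `p n = p 0`, each edge at `p 0` is represented
only once, by `(0, j)` with `j < β` or by `(j, n)` with `β ≤ j`. -/
lemma IsPolygon.card_le_ncard_goodEdges {P : Finset Plane} {n : ℕ} {σ : ℝ} {p : ℕ → Plane}
    (h : IsPolygon P n σ p) (β : ℕ) (U : Finset (ℕ × ℕ))
    (hU : ∀ x ∈ U, x.1 < x.2 ∧ x.2 ≤ n ∧ (x.1 = 0 → x.2 < β) ∧ (x.2 = n → β ≤ x.1))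
    (hgood : ∀ x ∈ U, IsGood P (p x.1) (p x.2)) : U.card ≤ (goodEdges P).ncard := by
  classical
  have hinj : Set.InjOn (fun x : ℕ × ℕ => s(p x.1, p x.2)) U := by
    rintro ⟨i, j⟩ hx ⟨i', j'⟩ hy hxy
    have h1 := hU _ hx
    have h2 := hU _ hy
    simp only at h1 h2
    have hmod : ∀ a b, a ≤ n → b ≤ n → p a = p b → a = b ∨ a = 0 ∧ b = n ∨ a = n ∧ b = 0 := by
      intro a b ha hb hab
      rcases ha.eq_or_lt with rfl | ha
      · rcases hb.eq_or_lt with rfl | hb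
        · exact Or.inl rfl
        · rw [h.closed] at hab
          have := h.inj 0 (by omega) b hb hab
          omega
      · rcases hb.eq_or_lt with rfl | hb
        · rw [h.closed] at hab
          have := h.inj a ha 0 (by omega) hab
          omega
        · exact Or.inl (h.inj a ha b hb hab)
    simp only [Sym2.eq_iff] at hxy
    rw [Prod.mk.injEq]
    rcases hxy with ⟨e1, e2⟩ | ⟨e1, e2⟩
    · have := hmod _ _ (by omega) (by omega) e1
      have := hmod _ _ (by omega) (by omega) e2
      omega
    · have := hmod _ _ (by omega) (by omega) e1
      have := hmod _ _ (by omega) (by omega) e2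
      omega
  rw [← Finset.card_image_of_injOn hinj, ← Set.ncard_coe_finset]
  refine Set.ncard_le_ncard ?_ (goodEdges_finite P)
  intro e he
  rw [Finset.mem_coe, Finset.mem_image] at he
  obtain ⟨x, hx, rfl⟩ := he
  have h1 := hU x hx
  exact ⟨_, h.mem _ (by omega), _, h.mem _ h1.2.1, h.ne h1.1 h1.2.1 (by omega), hgood x hx, rfl⟩

open Classical in
lemma IsPolygon.card_good_arcPairs {P : Finset Plane} {n : ℕ} {σ : ℝ} {p : ℕ → Plane}
    (h : IsPolygon P n σ p) {s N : ℕ} (hs : s + N ≤ n) (hN : N < n)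
    (hA : IsObtuseArc p s (s + N)) :
    N * (N + 2) + 4 * ∑ k ∈ Finset.range (N + 1), matchDefect p s (s + N) (s + k)
      ≤ 4 * ((arcPairs s (s + N)).filter fun x => IsGood P (p x.1) (p x.2)).card :=
  _root_.card_good_arcPairs hA fun _ _ h1 h2 h3 hg =>
    (h.exists_apex_of_not_isGood h2 (by omega) (by omega) hg).1

/-- If the minimum enclosing circle has two diametral contact points, two obtuse arcs cover `P`. -/
lemma IsPolygon.sq_le_of_two_arcs {P : Finset Plane} {n : ℕ} {σ : ℝ} {p : ℕ → Plane}
    (h : IsPolygon P n σ p) {α : ℕ} (h0 : 0 < α) (hα : α < n) (hA : IsObtuseArc p 0 α)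
    (hB : IsObtuseArc p α n) : n ^ 2 ≤ 8 * (goodEdges P).ncard := by
  classical
  obtain ⟨γ, rfl⟩ := Nat.exists_eq_add_of_lt hα
  rw [add_assoc] at h hα hB ⊢
  set c := γ + 1 with hc
  rw [← zero_add α] at hA
  have e1 := h.card_good_arcPairs (by omega) (by omega) hA
  have e2 := h.card_good_arcPairs (by omega) (by omega) hB
  set GA := (arcPairs 0 (0 + α)).filter fun x => IsGood P (p x.1) (p x.2) with hGA
  set GB := (arcPairs α (α + c)).filter fun x => IsGood P (p x.1) (p x.2) with hGB
  have mA : ∀ x ∈ GA, (0 ≤ x.1 ∧ x.1 < x.2 ∧ x.2 ≤ 0 + α) ∧ IsGood P (p x.1) (p x.2) := fun x hx =>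
    ⟨mem_arcPairs.1 (Finset.mem_filter.1 hx).1, (Finset.mem_filter.1 hx).2⟩
  have mB : ∀ x ∈ GB.erase (α, α + c), (α ≤ x.1 ∧ x.1 < x.2 ∧ x.2 ≤ α + c) ∧
      IsGood P (p x.1) (p x.2) ∧ ¬ (x.1 = α ∧ x.2 = α + c) := fun x hx => by
    obtain ⟨hne, hx⟩ := Finset.mem_erase.1 hx
    exact ⟨mem_arcPairs.1 (Finset.mem_filter.1 hx).1, (Finset.mem_filter.1 hx).2,
      fun e => hne (Prod.ext e.1 e.2)⟩
  have hdis : Disjoint GA (GB.erase (α, α + c)) := Finset.disjoint_left.2 fun x hx hy => by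
    have := mA x hx; have := mB x hy; omega
  have key := h.card_le_ncard_goodEdges (α + 1) (GA ∪ GB.erase (α, α + c))
    (fun x hx => by
      rcases Finset.mem_union.1 hx with hx | hx
      · have := mA x hx; omega
      · have := mB x hx; omega)
    (fun x hx => by
      rcases Finset.mem_union.1 hx with hx | hx
      · exact (mA x hx).2
      · exact (mB x hx).2.1)
  rw [Finset.card_union_of_disjoint hdis] at key
  have := Finset.pred_card_le_card_erase (s := GB) (a := (α, α + c))
  have e3 : α * (α + 2) + c * (c + 2) ≤ 4 * (goodEdges P).ncard + 4 := by omega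
  zify at e3 ⊢
  have : (2 : ℤ) ≤ α + c := by omega
  nlinarith [sq_nonneg ((α : ℤ) - c)]

/-! ### Numerical estimates -/

lemma add_add_sq_le (x y z : ℝ) : (x + y + z) ^ 2 ≤ 3 * (x ^ 2 + y ^ 2 + z ^ 2) := by
  nlinarith [sq_nonneg (x - y), sq_nonneg (x - z), sq_nonneg (y - z)]

/-- Three numbers with a nearly minimal sum of squares are nearly equal. -/
lemma le_of_sq_add_sq_add_sq_le {n x y z : ℝ} (hn : 0 < n) (hxyz : n = x + y + z)
    (hsq : x ^ 2 + y ^ 2 + z ^ 2 ≤ 0.33387 * n ^ 2) : 0.314 * n ≤ x := by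
  by_contra! hlt
  have h1 : (n - x) ^ 2 ≤ 2 * (y ^ 2 + z ^ 2) := by
    rw [hxyz]; nlinarith [sq_nonneg (y - z)]
  have h2 : 0 < (0.314 * n - x) * (n - 1.5 * (x + 0.314 * n)) :=
    mul_pos (by linarith) (by linarith)
  nlinarith [mul_pos hn hn]

/-- The good edges between two arcs outnumber the deficit, for large `n`. -/
lemma sq_le_of_cross_estimate {n L l k a K X Δ : ℝ} (hn : 3700 < n) (hK0 : 0 ≤ K)
    (hL : 157 / 1000 * n - 1 ≤ L) (hl : n / 64 - 1 ≤ l)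
    (hl' : l ≤ n / 64) (hk : k ≤ n / 86 + 1) (ha : a ≤ (2 * L + 2 * k) / 3 + 1)
    (hΔ : Δ ≤ 0.0001322 * n ^ 2) (hK : 3 * (K * (K + 1)) ≤ 4 * Δ)
    (hX : (L - l) * l ≤ X + (a + 2 + K) * l) : 0.0002 * n ^ 2 ≤ X := by
  have hn0 : 0 < n := by linarith
  have hKn : K ≤ 0.01328 * n := by
    by_contra! hlt
    nlinarith [mul_pos hn0 (sub_pos.2 hlt)]
  have h0 : 0.0143 * n ≤ L - l - (a + 2 + K) := by linarith
  have h1 : 0.0153 * n ≤ l := by linarith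
  have h2 : 0.0143 * n * (0.0153 * n) ≤ (L - l - (a + 2 + K)) * l :=
    mul_le_mul h0 h1 (by positivity) (by linarith)
  nlinarith [mul_pos hn0 hn0]

/-! ### The lower bound for good edges -/

open Classical in
/-- The case of three obtuse arcs with a wide angle at the corner `p 0`, labelled so that the
`n / 64`-th point before `p n` is not farther from `p 0` than the `n / 64`-th point after `p 0`. -/
lemma IsPolygon.sq_div_le_of_three_arcs_of_dist_le {P : Finset Plane} {n : ℕ} {σ : ℝ}
    {p : ℕ → Plane} (h : IsPolygon P n σ p) {α β : ℕ} (h0 : 0 < α) (hαβ : α < β) (hβ : β < n)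
    (hA : IsObtuseArc p 0 α) (hC : IsObtuseArc p α β) (hB : IsObtuseArc p β n)
    (hang : inner ℝ (p α - p 0) (p β - p 0) ≤ 1 / 2 * (‖p α - p 0‖ * ‖p β - p 0‖))
    (hdist : dist (p 0) (p (n - n / 64)) ≤ dist (p 0) (p (n / 64))) :
    (n : ℝ) ^ 2 / 11.981 ≤ ((goodEdges P).ncard : ℝ) := by
  obtain ⟨γ, rfl⟩ := Nat.exists_eq_add_of_le hαβ.le
  obtain ⟨δ, hc⟩ := Nat.exists_eq_add_of_le hβ.le
  by_contra! hcon
  have e1 := h.card_good_arcPairs (s := 0) (N := α) (by omega) (by omega) (by rwa [zero_add])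
  have e2 := h.card_good_arcPairs (s := α) (N := γ) (by omega) (by omega) hC
  have e3 := h.card_good_arcPairs (s := α + γ) (N := δ) (by omega) (by omega) (by rwa [← hc])
  rw [← hc] at e3
  simp only [zero_add] at e1
  set Δ := ∑ k ∈ Finset.range (α + 1), matchDefect p 0 α k with hΔ
  set GA := (arcPairs 0 α).filter fun x => IsGood P (p x.1) (p x.2) with hGA
  set GC := (arcPairs α (α + γ)).filter fun x => IsGood P (p x.1) (p x.2) with hGC
  set GB := (arcPairs (α + γ) n).filter fun x => IsGood P (p x.1) (p x.2) with hGB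
  have mA : ∀ x ∈ GA, (0 ≤ x.1 ∧ x.1 < x.2 ∧ x.2 ≤ α) ∧ IsGood P (p x.1) (p x.2) := fun x hx =>
    ⟨mem_arcPairs.1 (Finset.mem_filter.1 hx).1, (Finset.mem_filter.1 hx).2⟩
  have mC : ∀ x ∈ GC, (α ≤ x.1 ∧ x.1 < x.2 ∧ x.2 ≤ α + γ) ∧ IsGood P (p x.1) (p x.2) :=
    fun x hx => ⟨mem_arcPairs.1 (Finset.mem_filter.1 hx).1, (Finset.mem_filter.1 hx).2⟩
  have mB : ∀ x ∈ GB, (α + γ ≤ x.1 ∧ x.1 < x.2 ∧ x.2 ≤ n) ∧ IsGood P (p x.1) (p x.2) :=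
    fun x hx => ⟨mem_arcPairs.1 (Finset.mem_filter.1 hx).1, (Finset.mem_filter.1 hx).2⟩
  have dAC : Disjoint GA GC := Finset.disjoint_left.2 fun x hx hy => by
    have := mA x hx; have := mC x hy; omega
  have dB : Disjoint (GA ∪ GC) GB := Finset.disjoint_left.2 fun x hx hy => by
    have := mB x hy
    rcases Finset.mem_union.1 hx with hx | hx
    · have := mA x hx; omega
    · have := mC x hx; omega
  -- the good edges inside the arcs and any set `X` of good edges from the first to the last arc
  have htotal : ∀ X : Finset (ℕ × ℕ), (∀ x ∈ X, (1 ≤ x.1 ∧ x.1 < α ∧ α + γ ≤ x.2 ∧ x.2 < n) ∧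
      IsGood P (p x.1) (p x.2)) → GA.card + GC.card + GB.card + X.card ≤ (goodEdges P).ncard := by
    intro X mX
    have dX : Disjoint (GA ∪ GC ∪ GB) X := Finset.disjoint_left.2 fun x hx hy => by
      have := mX x hy
      rcases Finset.mem_union.1 hx with hx | hx
      · rcases Finset.mem_union.1 hx with hx | hx
        · have := mA x hx; omega
        · have := mC x hx; omega
      · have := mB x hx; omega
    rw [← Finset.card_union_of_disjoint dAC, ← Finset.card_union_of_disjoint dB,
      ← Finset.card_union_of_disjoint dX]
    refine h.card_le_ncard_goodEdges (α + γ) _ (fun x hx => ?_) (fun x hx => ?_)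
    · rcases Finset.mem_union.1 hx with hx | hx
      · rcases Finset.mem_union.1 hx with hx | hx
        · rcases Finset.mem_union.1 hx with hx | hx
          · have := mA x hx; omega
          · have := mC x hx; omega
        · have := mB x hx; omega
      · have := mX x hx; omega
    · rcases Finset.mem_union.1 hx with hx | hx
      · rcases Finset.mem_union.1 hx with hx | hx
        · rcases Finset.mem_union.1 hx with hx | hx
          · exact (mA x hx).2
          · exact (mC x hx).2
        · exact (mB x hx).2
      · exact (mX x hx).2
  set G := (goodEdges P).ncard with hG
  have hbase : α * (α + 2) + γ * (γ + 2) + δ * (δ + 2) + 4 * Δ ≤ 4 * G := by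
    have := htotal ∅ (by simp)
    simp only [Finset.card_empty] at this
    omega
  have hn : (n : ℝ) = α + γ + δ := by rw [hc]; push_cast; ring
  have hbaseR : (α : ℝ) * (α + 2) + γ * (γ + 2) + δ * (δ + 2) + 4 * Δ ≤ 4 * G := by
    exact_mod_cast hbase
  have hconR : (G : ℝ) * 11.981 < n ^ 2 := by rwa [lt_div_iff₀ (by norm_num)] at hcon
  have hΔ0 : (0 : ℝ) ≤ Δ := Nat.cast_nonneg _
  have hα0 : (0 : ℝ) < α := by exact_mod_cast h0
  have hγ0 : (0 : ℝ) < γ := by exact_mod_cast (show 0 < γ by omega)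
  have hδ0 : (0 : ℝ) < δ := by exact_mod_cast (show 0 < δ by omega)
  have hn0 : (0 : ℝ) < n := by linarith
  have hsq := add_add_sq_le (α : ℝ) γ δ
  rw [← hn] at hsq
  -- the linear gain settles small `n`
  have hlarge : (3700 : ℝ) < n := by
    have h1 : 0 < (n : ℝ) * (n * 0.00053 - 2) := by
      norm_num at hconR
      linarith [sq_nonneg (n : ℝ)]
    have := pos_of_mul_pos_right h1 hn0.le
    linarith
  -- the arcs are nearly equally long
  have hsqs : (α : ℝ) ^ 2 + γ ^ 2 + δ ^ 2 ≤ 0.33387 * n ^ 2 := by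
    norm_num at hconR ⊢
    linarith [sq_nonneg (n : ℝ)]
  have hαlen := le_of_sq_add_sq_add_sq_le hn0 hn hsqs
  have hδlen := le_of_sq_add_sq_add_sq_le (x := (δ : ℝ)) (y := γ) (z := α) hn0 (by rw [hn]; ring)
    (by linarith)
  have hΔle : (Δ : ℝ) ≤ 0.0001322 * n ^ 2 := by
    norm_num at hconR ⊢
    linarith [sq_nonneg (n : ℝ)]
  -- `L` is at most half of an arc, so that defects measure unmatched points before `p t` for
  -- `t < L`; `l` roughly maximizes the number of good edges found; `k` has `Δ < k (k + 1)`
  set L := 157 * n / 1000 with hL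
  set l := n / 64 with hl
  set k := n / 86 + 1 with hk
  set a := (2 * L + 2 * k) / 3 + 1 with ha
  have hnN : 3700 < n := by exact_mod_cast hlarge
  have hαN : 314 * n ≤ 1000 * α := by
    have : (314 : ℝ) * n ≤ 1000 * α := by linarith
    exact_mod_cast this
  have hδN : 314 * n ≤ 1000 * δ := by
    have : (314 : ℝ) * n ≤ 1000 * δ := by linarith
    exact_mod_cast this
  have hLα : 2 * L ≤ α := by omega
  have hlL : l < L := by omega
  have hDle : ∑ t ∈ Finset.range L, matchDefect p 0 α t ≤ Δ :=
    Finset.sum_le_sum_of_subset fun t ht => by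
      rw [Finset.mem_range] at ht ⊢; omega
  have hkR : (n : ℝ) / 86 < k := by
    have : n < 86 * k := by omega
    have : (n : ℝ) < 86 * k := by exact_mod_cast this
    linarith
  have hkR' : (k : ℝ) ≤ n / 86 + 1 := by
    have : 86 * k ≤ n + 86 := by omega
    have : (86 : ℝ) * k ≤ n + 86 := by exact_mod_cast this
    linarith
  have hΔk : Δ < k * (k + 1) := by
    have h1 : (n : ℝ) / 86 * (n / 86) ≤ k * k :=
      mul_le_mul hkR.le hkR.le (by positivity) (Nat.cast_nonneg _)
    have : (Δ : ℝ) < k * (k + 1) := by linarith [sq_nonneg (n : ℝ)]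
    exact_mod_cast this
  have hcorner : ∀ r y, l < r → r ≤ L → y ∈ Finset.Ico (n - l) n →
      dist (p n) (p y) ≤ dist (p n) (p r) := by
    intro r y h1 h2 h3
    rw [Finset.mem_Ico] at h3
    have d1 : dist (p n) (p y) ≤ dist (p n) (p (n - l)) := by
      rcases h3.1.eq_or_lt with e | hlt
      · rw [e]
      · exact (hB.dist_lt_left (by omega) hlt h3.2 le_rfl).le
    have d2 : dist (p 0) (p l) < dist (p 0) (p r) :=
      hA.dist_lt_right le_rfl (by omega) h1 (by omega)
    rw [h.closed] at d1 ⊢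
    linarith
  obtain ⟨K, hK, hKD⟩ := card_good_cross (l := l) (L := L) (h := k) (a := a) hA hLα
    (hDle.trans_lt hΔk) (by omega) (Finset.Ico (n - l) n)
    (good := fun r y => IsGood P (p r) (p y))
    (by
      intro r y h1 h2 h3 hbad
      have h4 := hcorner r y h1 h2 h3
      rw [Finset.mem_Ico] at h3
      obtain ⟨-, t, htn, ht, hd⟩ :=
        h.exists_apex_of_not_isGood (i := r) (j := y) (by omega) h3.2.le (by omega) hbad
      rcases ht with ht | ht
      · exact ⟨t, ht, hd⟩
      · -- the apex cannot lie between `p y` and the corner, which is closer to `p y`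
        refine (dist_ne_of_convex_quadrilateral (σ := σ) (x := p r) (y := p y) (b := p t)
          (v := p n) ?_ ?_ ?_ h4 hd).elim
        · exact h.orient _ _ _ ht htn le_rfl (by omega)
        · exact h.orient _ _ _ (by omega) htn le_rfl (by omega)
        · exact h.orient _ _ _ (by omega) ht (by omega) (by omega))
    (by
      intro t y h1 h2 h3
      rw [Finset.mem_Ico] at h3
      exact half_dist_sq_le_of_inner_le (h.inner_le_of_corner h1 (by omega) hαβ (by omega) h3.2
        (by norm_num) hang))
  rw [Nat.card_Ico] at hK
  have hcross := htotal _ (fun x hx => by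
    obtain ⟨hx, hg⟩ := Finset.mem_filter.1 hx
    obtain ⟨h1, h2⟩ := Finset.mem_product.1 hx
    rw [Finset.mem_Ioc] at h1
    rw [Finset.mem_Ico] at h2
    exact ⟨by omega, hg⟩ : ∀ x ∈ (Finset.Ioc l L ×ˢ Finset.Ico (n - l) n).filter
      (fun x => IsGood P (p x.1) (p x.2)), _)
  set X := ((Finset.Ioc l L ×ˢ Finset.Ico (n - l) n).filter
      (fun x => IsGood P (p x.1) (p x.2))).card with hX
  have hnl : n - (n - l) = l := by omega
  rw [hnl] at hK
  have hKΔ : 3 * (K * (K + 1)) ≤ 4 * Δ := hKD.trans (by omega)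
  have hKR : (3 : ℝ) * (K * (K + 1)) ≤ 4 * Δ := by exact_mod_cast hKΔ
  have hLR : (157 / 1000 : ℝ) * n - 1 ≤ L := by
    have : 157 * n ≤ 1000 * L + 1000 := by omega
    have : (157 : ℝ) * n ≤ 1000 * L + 1000 := by exact_mod_cast this
    linarith
  have hlR : (n : ℝ) / 64 - 1 ≤ l := by
    have : n ≤ 64 * l + 64 := by omega
    have : (n : ℝ) ≤ 64 * l + 64 := by exact_mod_cast this
    linarith
  have hlR' : (l : ℝ) ≤ n / 64 := by
    have : 64 * l ≤ n := by omega
    have : (64 : ℝ) * l ≤ n := by exact_mod_cast this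
    linarith
  have haR : (a : ℝ) ≤ (2 * L + 2 * k) / 3 + 1 := by
    have : 3 * a ≤ 2 * L + 2 * k + 3 := by omega
    have : (3 : ℝ) * a ≤ 2 * L + 2 * k + 3 := by exact_mod_cast this
    linarith
  have hKR2 : ((L : ℝ) - l) * l ≤ X + (a + 2 + K) * l := by
    have : (((L - l : ℕ) : ℝ)) * l ≤ X + (a + 2 + K) * l := by exact_mod_cast hK
    rwa [Nat.cast_sub hlL.le] at this
  have hXR := sq_le_of_cross_estimate hlarge (Nat.cast_nonneg K) hLR hlR hlR' hkR' haR hΔle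
    hKR hKR2
  have hfin : (α : ℝ) * (α + 2) + γ * (γ + 2) + δ * (δ + 2) + 4 * X ≤ 4 * G := by
    have : α * (α + 2) + γ * (γ + 2) + δ * (δ + 2) + 4 * X ≤ 4 * G := by omega
    exact_mod_cast this
  norm_num at hconR hXR
  linarith [sq_nonneg (n : ℝ)]

/-- Reversing the labelling exchanges the two arcs at `p 0`, which settles the comparison of
distances that `IsPolygon.sq_div_le_of_three_arcs_of_dist_le` assumes. -/
lemma IsPolygon.sq_div_le_of_three_arcs {P : Finset Plane} {n : ℕ} {σ : ℝ}
    {p : ℕ → Plane} (h : IsPolygon P n σ p) {α β : ℕ} (h0 : 0 < α) (hαβ : α < β) (hβ : β < n)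
    (hA : IsObtuseArc p 0 α) (hC : IsObtuseArc p α β) (hB : IsObtuseArc p β n)
    (hang : inner ℝ (p α - p 0) (p β - p 0) ≤ 1 / 2 * (‖p α - p 0‖ * ‖p β - p 0‖)) :
    (n : ℝ) ^ 2 / 11.981 ≤ ((goodEdges P).ncard : ℝ) := by
  rcases le_total (dist (p 0) (p (n - n / 64))) (dist (p 0) (p (n / 64))) with hd | hd
  · exact h.sq_div_le_of_three_arcs_of_dist_le h0 hαβ hβ hA hC hB hang hd
  · have e1 : n - (n - α) = α := by omega
    have e2 : n - (n - β) = β := by omega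
    have e3 : n - (n - n / 64) = n / 64 := by omega
    refine h.reverse.sq_div_le_of_three_arcs_of_dist_le (α := n - β) (β := n - α)
      (by omega) (by omega) (by omega) ?_ (hC.reverse (by omega)) ?_ ?_ ?_
    · have := hB.reverse (n := n) le_rfl
      rwa [Nat.sub_self] at this
    · have := hA.reverse (n := n) (by omega)
      rwa [Nat.sub_zero] at this
    · simp only [e1, e2, Nat.sub_zero, h.closed]
      rw [real_inner_comm, mul_comm ‖p β - p 0‖]
      exact hang
    · simp only [e3, Nat.sub_zero, h.closed]
      exact hd

/-- The centre lies on the inner side of every chord between contact points. -/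
lemma signedArea_nonneg_of_mem_convexHull {σ : ℝ} {a b c o : Plane}
    (ho : o ∈ convexHull ℝ ({a, b, c} : Set Plane)) (h : 0 ≤ σ * signedArea a b c) :
    0 ≤ σ * signedArea a b o := by
  have hconv : Convex ℝ {z : Plane | 0 ≤ σ * signedArea a b z} := by
    intro x hx y hy s t hs ht hst
    simp only [Set.mem_ofPred_eq] at hx hy ⊢
    have : σ * signedArea a b (s • x + t • y)
        = s * (σ * signedArea a b x) + t * (σ * signedArea a b y) := by
      simp only [signedArea_eq, PiLp.add_apply, PiLp.smul_apply, smul_eq_mul]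
      linear_combination (σ * ((b 0 - a 0) * a 1 - (b 1 - a 1) * a 0)) * hst
    rw [this]
    positivity
  refine convexHull_min ?_ hconv ho
  rintro z (rfl | rfl | rfl)
  · simp only [Set.mem_ofPred_eq, signedArea_eq]; ring_nf; rfl
  · simp only [Set.mem_ofPred_eq, signedArea_eq]; ring_nf; rfl
  · exact h

lemma sq_div_le_of_two_contacts {P : Finset Plane} {n : ℕ} (hn : 2 ≤ n) (hcard : P.card = n)
    (hP : InConvexPosition P) {o : Plane} {R : ℝ} (hR : ∀ x ∈ P, dist x o ≤ R) {a b : Plane}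
    (hab : a ≠ b) (ha : a ∈ P) (hb : b ∈ P) (haR : dist a o = R) (hbR : dist b o = R)
    (ho : o ∈ convexHull ℝ ({a, b} : Set Plane)) : n ^ 2 ≤ 8 * (goodEdges P).ncard := by
  obtain ⟨p, h, rfl⟩ := exists_isPolygon hn hcard hP ha
  obtain ⟨α, hα, rfl⟩ := h.surj b hb
  have h0 : 0 < α := Nat.pos_of_ne_zero fun e => hab (by rw [e])
  have e1 : ({p 0, p α, p 0} : Set Plane) = {p 0, p α} := by ext; simp; tauto
  have e2 : ({p α, p 0, p 0} : Set Plane) = {p 0, p α} := by ext; simp; tauto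
  refine h.sq_le_of_two_arcs h0 hα ?_ ?_
  · refine h.isObtuseArc_of_chord hα.le (by omega) hR haR hbR
      (signedArea_nonneg_of_mem_convexHull (c := p 0) (by rwa [e1]) ?_)
    simp only [signedArea_eq]; ring_nf; rfl
  · refine h.isObtuseArc_of_chord le_rfl (by omega) hR hbR (by rw [h.closed]; exact haR) ?_
    rw [h.closed]
    refine signedArea_nonneg_of_mem_convexHull (c := p 0) (by rwa [e2]) ?_
    simp only [signedArea_eq]; ring_nf; rfl

/-- Three contact points, of which `v` is opposite to the longest side. -/
lemma sq_div_le_of_three_contacts {P : Finset Plane} {n : ℕ} (hn : 2 ≤ n) (hcard : P.card = n)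
    (hP : InConvexPosition P) {o : Plane} {R : ℝ} (hR : ∀ x ∈ P, dist x o ≤ R) {v u x : Plane}
    (hvu : v ≠ u) (hvx : v ≠ x) (hux : u ≠ x) (hv : v ∈ P) (hu : u ∈ P) (hx : x ∈ P)
    (hvR : dist v o = R) (huR : dist u o = R) (hxR : dist x o = R)
    (ho : o ∈ convexHull ℝ ({v, u, x} : Set Plane))
    (h1 : dist u v ≤ dist u x) (h2 : dist x v ≤ dist u x) :
    (n : ℝ) ^ 2 / 11.981 ≤ ((goodEdges P).ncard : ℝ) := by
  obtain ⟨p, h, rfl⟩ := exists_isPolygon hn hcard hP hv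
  obtain ⟨i, hi, rfl⟩ := h.surj u hu
  obtain ⟨j, hj, rfl⟩ := h.surj x hx
  have hi0 : 0 < i := Nat.pos_of_ne_zero fun e => hvu (by rw [e])
  have hj0 : 0 < j := Nat.pos_of_ne_zero fun e => hvx (by rw [e])
  have key : ∀ α β, 0 < α → α < β → β < n → dist (p α) o = R → dist (p β) o = R →
      o ∈ convexHull ℝ ({p 0, p α, p β} : Set Plane) →
      inner ℝ (p α - p 0) (p β - p 0) ≤ 1 / 2 * (‖p α - p 0‖ * ‖p β - p 0‖) →
      (n : ℝ) ^ 2 / 11.981 ≤ ((goodEdges P).ncard : ℝ) := by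
    intro α β h0 hαβ hβ hαR hβR ho hang
    have harea := (h.orient 0 α β h0 hαβ hβ.le (by omega)).le
    have e1 : ({p α, p β, p 0} : Set Plane) = {p 0, p α, p β} := by ext; simp; tauto
    have e2 : ({p β, p 0, p α} : Set Plane) = {p 0, p α, p β} := by ext; simp; tauto
    refine h.sq_div_le_of_three_arcs h0 hαβ hβ ?_ ?_ ?_ hang
    · exact h.isObtuseArc_of_chord (by omega) (by omega) hR hvR hαR
        (signedArea_nonneg_of_mem_convexHull ho harea)
    · refine h.isObtuseArc_of_chord hβ.le (by omega) hR hαR hβR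
        (signedArea_nonneg_of_mem_convexHull (c := p 0) (by rwa [e1]) ?_)
      rw [signedArea_rotate]; exact harea
    · refine h.isObtuseArc_of_chord le_rfl (by omega) hR hβR (by rw [h.closed]; exact hvR) ?_
      rw [h.closed]
      refine signedArea_nonneg_of_mem_convexHull (c := p α) (by rwa [e2]) ?_
      rw [← signedArea_rotate]; exact harea
  have hang := inner_le_half_of_longest h1 h2
  rcases lt_trichotomy i j with hij | hij | hij
  · exact key i j hi0 hij hj huR hxR ho hang
  · exact absurd (by rw [hij]) hux
  · refine key j i hj0 hij hi hxR huR ?_ ?_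
    · have e : ({p 0, p j, p i} : Set Plane) = {p 0, p i, p j} := by ext; simp; tauto
      rwa [e]
    · rw [real_inner_comm, mul_comm ‖p j - p 0‖]; exact hang

lemma sq_div_le_ncard_goodEdges {P : Finset Plane} {n : ℕ} (hn : 2 ≤ n) (hcard : P.card = n)
    (hP : InConvexPosition P) : (n : ℝ) ^ 2 / 11.981 ≤ ((goodEdges P).ncard : ℝ) := by
  obtain ⟨o, R, hR, ⟨a, b, hab, ha, hb, haR, hbR, ho⟩ |
    ⟨a, b, c, hab, hac, hbc, ha, hb, hc, haR, hbR, hcR, ho⟩⟩ :=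
    exists_contact_points (P := P) (by omega)
  · have := sq_div_le_of_two_contacts hn hcard hP hR hab ha hb haR hbR ho
    have h8 : (n : ℝ) ^ 2 ≤ 8 * (goodEdges P).ncard := by exact_mod_cast this
    rw [div_le_iff₀ (by norm_num)]
    nlinarith [sq_nonneg (n : ℝ)]
  · have e1 : ({b, a, c} : Set Plane) = {a, b, c} := by ext; simp; tauto
    have e2 : ({c, a, b} : Set Plane) = {a, b, c} := by ext; simp; tauto
    rcases le_total (dist b c) (dist a c) with h1 | h1
    · rcases le_total (dist a c) (dist a b) with h2 | h2
      · exact sq_div_le_of_three_contacts hn hcard hP hR hac.symm hbc.symm hab hc ha hb hcR haR hbR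
          (by rwa [e2]) h2 (h1.trans h2)
      · exact sq_div_le_of_three_contacts hn hcard hP hR hab.symm hbc hac hb ha hc hbR haR hcR
          (by rwa [e1]) h2 (by rwa [dist_comm c b])
    · rcases le_total (dist b c) (dist a b) with h2 | h2
      · exact sq_div_le_of_three_contacts hn hcard hP hR hac.symm hbc.symm hab hc ha hb hcR haR hbR
          (by rwa [e2]) (h1.trans h2) h2
      · exact sq_div_le_of_three_contacts hn hcard hP hR hab hac hbc ha hb hc haR hbR hcR ho
          (by rwa [dist_comm b a]) (by rwa [dist_comm c a])

/-! ### From good edges to isosceles triangles -/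

open Classical in
/-- The points of `P` on the perpendicular bisector of an edge. -/
noncomputable def bisectorPoints (P : Finset Plane) (e : Sym2 Plane) : Finset Plane :=
  P.filter fun x => ∀ a ∈ e, ∀ b ∈ e, dist x a = dist x b

lemma mem_bisectorPoints {P : Finset Plane} {a b x : Plane} :
    x ∈ bisectorPoints P s(a, b) ↔ x ∈ P ∧ dist x a = dist x b := by
  simp only [bisectorPoints, Finset.mem_filter, Sym2.mem_iff, forall_eq_or_imp, forall_eq]
  constructor
  · exact fun h => ⟨h.1, h.2.1.2⟩
  · exact fun h => ⟨h.1, ⟨trivial, h.2⟩, h.2.symm, trivial⟩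

/-- A line meets the vertex set of a convex polygon in at most two points. -/
lemma IsPolygon.card_bisectorPoints_le {P : Finset Plane} {n : ℕ} {σ : ℝ} {p : ℕ → Plane}
    (h : IsPolygon P n σ p) {a b : Plane} (hab : a ≠ b) :
    (bisectorPoints P s(a, b)).card ≤ 2 := by
  classical
  by_contra! hcard
  obtain ⟨x, y, z, hx, hy, hz, hxy, hxz, hyz⟩ := Finset.two_lt_card_iff.1 hcard
  rw [mem_bisectorPoints] at hx hy hz
  have harea : ∀ x y z : Plane, dist x a = dist x b → dist y a = dist y b → dist z a = dist z b →
      signedArea x y z = 0 := by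
    intro x y z hx hy hz
    rw [plane_dist_eq_iff, plane_dist_sq, plane_dist_sq] at hx hy hz
    have hne : a 0 - b 0 ≠ 0 ∨ a 1 - b 1 ≠ 0 := by
      by_contra! h0
      refine hab ?_
      ext i
      fin_cases i
      · exact sub_eq_zero.1 h0.1
      · exact sub_eq_zero.1 h0.2
    have hy' : (y 0 - x 0) * (a 0 - b 0) + (y 1 - x 1) * (a 1 - b 1) = 0 := by linarith
    have hz' : (z 0 - x 0) * (a 0 - b 0) + (z 1 - x 1) * (a 1 - b 1) = 0 := by linarith
    rw [signedArea_eq]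
    rcases hne with h0 | h0
    · refine (mul_eq_zero.1 ?_).resolve_right h0
      linear_combination (z 1 - x 1) * hy' - (y 1 - x 1) * hz'
    · refine (mul_eq_zero.1 ?_).resolve_right h0
      linear_combination (y 0 - x 0) * hz' - (z 0 - x 0) * hy'
  obtain ⟨i, hi, rfl⟩ := h.surj x hx.1
  obtain ⟨j, hj, rfl⟩ := h.surj y hy.1
  obtain ⟨k, hk, rfl⟩ := h.surj z hz.1
  have hij : i ≠ j := fun e => hxy (by rw [e])
  have hik : i ≠ k := fun e => hxz (by rw [e])
  have hjk : j ≠ k := fun e => hyz (by rw [e])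
  have hord : ∀ i j k, i < j → j < k → k < n → dist (p i) a = dist (p i) b →
      dist (p j) a = dist (p j) b → dist (p k) a = dist (p k) b → False := by
    intro i j k h1 h2 h3 d1 d2 d3
    have := h.orient i j k h1 h2 h3.le (by omega)
    rw [harea _ _ _ d1 d2 d3, mul_zero] at this
    exact lt_irrefl _ this
  rcases lt_or_gt_of_ne hij with h1 | h1 <;> rcases lt_or_gt_of_ne hik with h2 | h2 <;>
    rcases lt_or_gt_of_ne hjk with h3 | h3
  · exact hord i j k h1 h3 hk hx.2 hy.2 hz.2
  · exact hord i k j h2 h3 hj hx.2 hz.2 hy.2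
  · omega
  · exact hord k i j h2 h1 hj hz.2 hx.2 hy.2
  · exact hord j i k h1 h2 hk hy.2 hx.2 hz.2
  · omega
  · exact hord j k i h3 h2 hi hy.2 hz.2 hx.2
  · exact hord k j i h3 h1 hi hz.2 hy.2 hx.2

/-- Each of the `n (n - 1) / 2` edges is the base of at most two isosceles triangles, each good
edge of at most one. -/
lemma numIsosceles_add_ncard_goodEdges_le {P : Finset Plane} {n : ℕ} (hn : 2 ≤ n)
    (hcard : P.card = n) (hP : InConvexPosition P) :
    numIsosceles P + (goodEdges P).ncard ≤ n * (n - 1) := by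
  classical
  obtain ⟨v, hv⟩ := Finset.card_pos.1 (show 0 < P.card by omega)
  obtain ⟨p, h, -⟩ := exists_isPolygon hn hcard hP hv
  set E : Finset (Sym2 Plane) := P.sym2.filter fun e => ¬ e.IsDiag with hE
  have hEcard : 2 * E.card = n * (n - 1) := by
    have h1 : E = P.offDiag.image Sym2.mk.uncurry := by
      ext e
      induction e with | _ a b
      simp only [hE, Finset.mem_filter, Finset.mk_mem_sym2_iff, Sym2.mk_isDiag_iff,
        Finset.mem_image, Finset.mem_offDiag, Prod.exists]
      constructor
      · rintro ⟨⟨ha, hb⟩, hab⟩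
        exact ⟨a, b, ⟨ha, hb, hab⟩, rfl⟩
      · rintro ⟨c, d, ⟨hc, hd, hcd⟩, he⟩
        rcases Sym2.eq_iff.1 he with ⟨rfl, rfl⟩ | ⟨rfl, rfl⟩
        · exact ⟨⟨hc, hd⟩, hcd⟩
        · exact ⟨⟨hd, hc⟩, hcd.symm⟩
    rw [h1, Sym2.two_mul_card_image_offDiag, Finset.offDiag_card, hcard, Nat.mul_sub_one]
  have hfin := goodEdges_finite P
  have hsub : hfin.toFinset ⊆ E := by
    intro e he
    rw [Set.Finite.mem_toFinset] at he
    obtain ⟨a, ha, b, hb, hab, -, rfl⟩ := he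
    simp [hE, ha, hb, hab]
  have hZ : numIsosceles P ≤ (E.sigma fun e => bisectorPoints P e).card := by
    have hss : isoscelesPairs P ⊆ ((E.sigma fun e => bisectorPoints P e).image
        fun x => x.1.map fun a => (x.2, a) : Finset (Sym2 (Plane × Plane))) := by
      rintro _ ⟨q, hq, a, ha, b, hb, -, -, hab, hd, rfl⟩
      rw [Finset.mem_coe, Finset.mem_image]
      refine ⟨⟨s(a, b), q⟩, ?_, by simp⟩
      rw [Finset.mem_sigma, mem_bisectorPoints]
      exact ⟨by simp [hE, ha, hb, hab], hq, hd⟩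
    rw [numIsosceles]
    refine (Set.ncard_le_ncard hss (Finset.finite_toSet _)).trans ?_
    rw [Set.ncard_coe_finset]
    exact Finset.card_image_le
  rw [Finset.card_sigma] at hZ
  have hsum : ∑ e ∈ E, (bisectorPoints P e).card + (goodEdges P).ncard ≤ ∑ e ∈ E, 2 := by
    have hg : (goodEdges P).ncard = ∑ e ∈ E, if e ∈ hfin.toFinset then 1 else 0 := by
      rw [Set.ncard_eq_toFinset_card _ hfin, ← Finset.card_filter, Finset.filter_mem_eq_inter,
        Finset.inter_eq_right.2 hsub]
    rw [hg, ← Finset.sum_add_distrib]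
    refine Finset.sum_le_sum fun e he => ?_
    split_ifs with hg
    · rw [Set.Finite.mem_toFinset] at hg
      obtain ⟨a, ha, b, hb, hab, hgood, rfl⟩ := hg
      have : (bisectorPoints P s(a, b)).card ≤ 1 := by
        rw [Finset.card_le_one]
        intro x hx y hy
        rw [mem_bisectorPoints] at hx hy
        exact hgood ⟨hx.1, AffineSubspace.mem_perpBisector_iff_dist_eq.2 hx.2⟩
          ⟨hy.1, AffineSubspace.mem_perpBisector_iff_dist_eq.2 hy.2⟩
      omega
    · induction e with | _ a b
      have hab : a ≠ b := by
        have := (Finset.mem_filter.1 he).2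
        simpa using this
      exact h.card_bisectorPoints_le hab
  rw [Finset.sum_const, smul_eq_mul] at hsum
  omega

theorem theorem2 (n : ℕ) (hn : 2 ≤ n) (P : Finset Plane) (hcard : P.card = n)
    (hP : InConvexPosition P) :
    (n : ℝ) ^ 2 / 11.981 ≤ ((goodEdges P).ncard : ℝ) ∧
      (numIsosceles P : ℝ) ≤ (10.981 / 11.981) * (n : ℝ) ^ 2 := by
  have h1 := sq_div_le_ncard_goodEdges hn hcard hP
  refine ⟨h1, ?_⟩
  have h2 := (numIsosceles_add_ncard_goodEdges_le hn hcard hP).trans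
    (Nat.mul_le_mul_left n (Nat.sub_le n 1))
  have h3 : (numIsosceles P : ℝ) + (goodEdges P).ncard ≤ n * n := by exact_mod_cast h2
  have h4 : (10.981 / 11.981) * (n : ℝ) ^ 2 = n * n - n ^ 2 / 11.981 := by ring
  linarith
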